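/- Let $d\ge 4$, $2\le k\le d-2$ and $m=\min\{d-k,k\}$. Write $\mathbb R^d=\mathbb R^{d-k}\times\mathbb R^k$ and let $G_k=O(d-k)\times O(k)\subset O(d)$ act block-diagonally. A function $f:\mathbb R^d\to\mathbb C$ is called $G_k$-symmetric if $f\circ A=f$ for every $A\in G_k$. Let $\sigma$ be the usual surface measure on the unit sphere $\mathbb S^{d-1}$, let $\widehat f(\xi)=\int_{\mathbb R^d}f(x)e^{-i\xi\cdot x}\,dx$ for $f\in L^1(\mathbb R^d)$, and let $L^{p,s}$ denote the Lorentz spaces, with quasi-norms $$\|f\|_{L^{p,1}(\mu)}=p\int_0^\infty \mu(\{|f|>t\})^{1/p}\,dt,\qquad \|f\|_{L^{p,\infty}(\mu)}=\sup_{t>0}\,t\,\mu(\{|f|>t\})^{1/p}.$$ Then there is a constant $C=C(k,d)<\infty$ such that $$\|\widehat f\|_{L^{\frac{2m}{m-1},\infty}(\mathbb S^{d-1})}\le C\,\|f\|_{L^{\frac{2m}{m+1},1}(\mathbb R^d)}$$ for every $G_k$-symmetric $f\in L^{\frac{2m}{m+1},1}(\mathbb R^d)$. Here, if $f$ is not integrable,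 $\widehat f|_{\mathbb S^{d-1}}$ is understood through the restriction operator: that is, the estimate holds for all $G_k$-symmetric $f\in L^1(\mathbb R^d)\cap L^{\frac{2m}{m+1},1}(\mathbb R^d)$, and there is a linear map $f\mapsto \mathcal Rf$ from the $G_k$-symmetric functions in $L^{\frac{2m}{m+1},1}(\mathbb R^d)$ to (classes modulo $\sigma$-null sets of) measurable functions on $\mathbb S^{d-1}$ with $\mathcal Rf=\widehat f|_{\mathbb S^{d-1}}$ $\sigma$-almost everywhere whenever $f$ is also integrable, and with $$\|\mathcal Rf\|_{L^{\frac{2m}{m-1},\infty}(\mathbb S^{d-1})}\le C\,\|f\|_{L^{\frac{2m}{m+1},1}(\mathbb R^d)}$$ for all of them, with the same constant $C$. -/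

import Mathlib

open MeasureTheory
open scoped ENNReal NNReal

noncomputable section

/-- The Lorentz quasi-norm of `L^{p,s}(μ)`, for `0 < p < ∞` and `0 < s ≤ ∞`, through the distribution
function `t ↦ μ {|f| > t}`: `sup_t t μ{|f| > t}^{1/p}` if `s = ∞`, and
`(p ∫_0^∞ (t μ{|f| > t}^{1/p})^s dt/t)^{1/s}` if `s < ∞`. -/
def eLorentzNorm {α : Type*} [MeasurableSpace α] (f : α → ℂ) (p : ℝ) (s : ℝ≥0∞)
    (μ : Measure α) : ℝ≥0∞ :=
  if s = ∞ then
    ⨆ t : ℝ≥0, (t : ℝ≥0∞) * μ {x | (t : ℝ) < ‖f x‖} ^ (1 / p)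
  else
    (ENNReal.ofReal p * ∫⁻ t in Set.Ioi (0 : ℝ),
      (ENNReal.ofReal t * μ {x | t < ‖f x‖} ^ (1 / p)) ^ s.toReal / ENNReal.ofReal t)
        ^ (1 / s.toReal)

/-- Membership in the Lorentz space `L^{p,s}(μ)`. -/
def MemLorentz {α : Type*} [MeasurableSpace α] (f : α → ℂ) (p : ℝ) (s : ℝ≥0∞)
    (μ : Measure α) : Prop :=
  AEStronglyMeasurable f μ ∧ eLorentzNorm f p s μ < ∞

/-- `ℝ^d = ℝ^{d-k} × ℝ^k` (for `k ≤ d`) with its Euclidean structure; the first `d - k` coordinates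
are those of `y`, the last `k` those of `z`. -/
abbrev BlockSpace (d k : ℕ) : Type := EuclideanSpace ℝ (Fin (d - k) ⊕ Fin k)

/-- The unit sphere `S^{d-1}`. -/
abbrev BlockSphere (d k : ℕ) : Type := Metric.sphere (0 : BlockSpace d k) 1

/-- The usual surface measure `σ` on `S^{d-1}`. -/
def surfaceMeasure (d k : ℕ) : Measure (BlockSphere d k) :=
  (volume : Measure (BlockSpace d k)).toSphere

/-- `f ∘ A = f` for every `A` in `G_k = O(d-k) × O(k)`, the group of block diagonal orthogonal
matrices. -/
def IsBlockSymmetric {d k : ℕ} (f : BlockSpace d k → ℂ) : Prop :=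
  ∀ U ∈ Matrix.orthogonalGroup (Fin (d - k)) ℝ, ∀ V ∈ Matrix.orthogonalGroup (Fin k) ℝ,
    f ∘ Matrix.toEuclideanLin (Matrix.fromBlocks U 0 0 V) = f

/-- The Fourier transform of an integrable function, `ξ ↦ ∫ f(x) e^{-i ξ·x} dx`. -/
def fourierHat {d k : ℕ} (f : BlockSpace d k → ℂ) (ξ : BlockSpace d k) : ℂ :=
  ∫ x, f x * Complex.exp (-Complex.I * ((inner ℝ ξ x : ℝ) : ℂ))

/-- `R` is a restriction operator `f ↦ f̂|_{S^{d-1}}` on the `G_k`-symmetric functions in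
`L^{p,s}(ℝ^d)`: it is linear there (up to `σ`-null sets), and it is given by the Fourier integral on
the functions that are also integrable. For `1 < p < ∞` and `s < ∞` these are dense, so that a
bounded `R` is the extension by continuity of the Fourier integral. -/
structure IsRestrictionOperator {d k : ℕ} (p : ℝ) (s : ℝ≥0∞)
    (R : (BlockSpace d k → ℂ) → BlockSphere d k → ℂ) : Prop where
  aestronglyMeasurable : ∀ f, IsBlockSymmetric f → MemLorentz f p s volume →
    AEStronglyMeasurable (R f) (surfaceMeasure d k)
  map_add : ∀ f g, IsBlockSymmetric f → MemLorentz f p s volume →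
    IsBlockSymmetric g → MemLorentz g p s volume →
    R (f + g) =ᵐ[surfaceMeasure d k] R f + R g
  map_smul : ∀ (c : ℂ) (f), IsBlockSymmetric f → MemLorentz f p s volume →
    R (c • f) =ᵐ[surfaceMeasure d k] c • R f
  eq_fourierHat : ∀ f, IsBlockSymmetric f → MemLorentz f p s volume → Integrable f volume →
    R f =ᵐ[surfaceMeasure d k] fun ω => fourierHat f ω

end

/-! Averaging over the rotations of one block replaces the plane wave in that block by the Fourier
transform of a sphere, of size `|w|^(-(n-1)/2)` with `n` the dimension of the block. On the unit
sphere one of the two frequency components has norm at least `1/√2`, so the decay is available in at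
least one block. Say that it is the second one, write points as `(x, y)` and frequencies as `(ξ₁,
ξ₂)`. On this part of the sphere the image of `σ` under `ξ ↦ ξ₁` has bounded density
(`exists_toSphere_le_of_fst_le_snd`).

Let `|g| ≤ 1` be symmetric and let `F` be a set of such frequencies. Cut `g` at `|y| = S`. The far
part has a transform bounded by a multiple of `S^(-(m-1)/2) ‖g‖₁`
(`exists_enorm_waveIntegral_le_of_tail`). For the near part, Cauchy-Schwarz in `y` costs the square
integral of the spherical wave over a ball of radius `S`, which is `O(S)` in every dimension;
Plancherel in `x` and the bounded density then give an `L²(σ)` bound of order `S^(1/2) ‖g‖₂`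
(`exists_lintegral_sq_waveIntegral_le`). The best `S` yields `∫_F |ĝ| ≲ (σ(F) ‖g‖₁)^r` with `r =
(m+1)/(2m)`.

This restricted inequality implies the Lorentz one: decomposing `f` into unimodular layers produces
the `L^{p,1}` norm on the right, and testing on superlevel sets of `f̂` produces the weak norm on
the left. For non-integrable `f` the truncations to balls are integrable, their transforms are
Cauchy in `L¹(σ)`, and the limit inherits the estimate. -/

/-! ### Plancherel for the Fourier integral on `L¹ ∩ L²`. -/

section Plancherel

open scoped FourierTransform SchwartzMap

variable {E : Type*} [NormedAddCommGroup E] [InnerProductSpace ℝ E] [FiniteDimensional ℝ E]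
  [MeasurableSpace E] [BorelSpace E]

/-- On `L¹ ∩ L²` the Fourier integral agrees almost everywhere with the `L²` Fourier transform. -/
theorem fourier_toLp_two_ae_eq {f : E → ℂ} (hf : Integrable f) (hf2 : MemLp f 2) :
    ((𝓕 (hf2.toLp f) : Lp (α := E) ℂ 2) : E → ℂ) =ᵐ[volume] 𝓕 f := by
  have hcont : Continuous (𝓕 f) :=
    VectorFourier.fourierIntegral_continuous Real.continuous_fourierChar
      (by exact continuous_inner) hf
  -- Both sides are tested against smooth compactly supported `g`; each pairing equals the integral
  -- of `f` against the transform of `g`.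
  refine ae_eq_of_integral_contDiff_smul_eq
    ((Lp.memLp _).locallyIntegrable (by norm_num)) hcont.locallyIntegrable ?_
  intro g hg hgc
  have hg1 : HasCompactSupport (Complex.ofRealCLM ∘ g) := hgc.comp_left rfl
  have hg2 : ContDiff ℝ ((⊤ : ℕ∞) : WithTop ℕ∞) (Complex.ofRealCLM ∘ g) := by fun_prop
  set φ : 𝓢(E, ℂ) := hg1.toSchwartzMap hg2 with hφ
  have hφx : ∀ x, φ x = (g x : ℂ) := fun x => rfl
  have h1 := congrArg (fun T => T φ) (Lp.fourier_toTemperedDistribution_eq (hf2.toLp f))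
  simp only [TemperedDistribution.fourier_apply, Lp.toTemperedDistribution_apply] at h1
  have h2 : ∫ ξ, φ ξ • 𝓕 f ξ = ∫ x, 𝓕 (φ : E → ℂ) x • f x := by
    have := VectorFourier.integral_fourierIntegral_smul_eq_flip (μ := (volume : Measure E))
      (ν := (volume : Measure E)) (e := Real.fourierChar) (L := innerₗ E)
      Real.continuous_fourierChar (by exact continuous_inner) φ.integrable hf
    rw [flip_innerₗ] at this
    exact this.symm
  calc ∫ x, g x • (𝓕 (hf2.toLp f) : Lp (α := E) ℂ 2 volume) x
      = ∫ x, φ x • (𝓕 (hf2.toLp f) : Lp (α := E) ℂ 2 volume) x := by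
        simp only [hφx, Complex.real_smul, smul_eq_mul]
    _ = ∫ x, 𝓕 (φ : E → ℂ) x • (hf2.toLp f) x := by rw [← h1]; rfl
    _ = ∫ x, 𝓕 (φ : E → ℂ) x • f x := by
        refine integral_congr_ae ?_
        filter_upwards [hf2.coeFn_toLp] with x hx
        rw [hx]
    _ = ∫ x, g x • 𝓕 f x := by
        rw [← h2]; simp only [hφx, Complex.real_smul, smul_eq_mul]

/-- Plancherel's theorem on `L¹ ∩ L²`. -/
theorem lintegral_enorm_sq_fourier {f : E → ℂ} (hf : Integrable f) (hf2 : MemLp f 2) :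
    ∫⁻ ξ, ‖𝓕 f ξ‖ₑ ^ 2 = ∫⁻ x, ‖f x‖ₑ ^ 2 := by
  have key : eLpNorm (𝓕 f) 2 volume = eLpNorm f 2 volume := by
    rw [← eLpNorm_congr_ae (fourier_toLp_two_ae_eq hf hf2), ← Lp.enorm_def,
      ← eLpNorm_congr_ae hf2.coeFn_toLp,
      ← Lp.enorm_def, ← ofReal_norm, ← ofReal_norm, Lp.norm_fourier_eq]
  have h : ∀ g : E → ℂ, ∫⁻ x, ‖g x‖ₑ ^ 2 = eLpNorm g 2 volume ^ 2 := by
    intro g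
    rw [eLpNorm_eq_lintegral_rpow_enorm_toReal (by norm_num) (by norm_num)]
    simp only [ENNReal.toReal_ofNat, ENNReal.rpow_ofNat]
    rw [← ENNReal.rpow_ofNat, ← ENNReal.rpow_mul]
    norm_num
  rw [h, h, key]

/-- Plancherel's inequality on `L¹ ∩ L²`, for the Fourier integral with the phase `e^{-i⟨ξ, x⟩}`. -/
theorem exists_lintegral_enorm_sq_fourierIntegral_le (E : Type*) [NormedAddCommGroup E]
    [InnerProductSpace ℝ E] [FiniteDimensional ℝ E] [MeasurableSpace E] [BorelSpace E] :
    ∃ C : ℝ≥0, ∀ f : E → ℂ, Integrable f → MemLp f 2 →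
      ∫⁻ ξ, ‖∫ x, f x * Complex.exp (-Complex.I * ((inner ℝ ξ x : ℝ) : ℂ))‖ₑ ^ 2
        ≤ C * ∫⁻ x, ‖f x‖ₑ ^ 2 := by
  -- The constant is the Jacobian of the dilation by `2π` that relates the two normalisations of the
  -- phase.
  refine ⟨((2 * Real.pi) ^ Module.finrank ℝ E).toNNReal, fun f hf hf2 => ?_⟩
  have hpi : (2 * Real.pi) ≠ 0 := by positivity
  have hF : ∀ ξ : E, ∫ x, f x * Complex.exp (-Complex.I * ((inner ℝ ξ x : ℝ) : ℂ))
      = 𝓕 f ((2 * Real.pi)⁻¹ • ξ) := by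
    intro ξ
    rw [Real.fourier_eq']
    refine integral_congr_ae (.of_forall fun x => ?_)
    simp only [smul_eq_mul]
    rw [mul_comm, inner_smul_right, real_inner_comm]
    congr 2
    have : -2 * Real.pi * ((2 * Real.pi)⁻¹ * inner ℝ x ξ) = - inner ℝ x ξ := by field_simp
    rw [this]; push_cast; ring
  simp_rw [hF]
  have hmeas : Continuous (𝓕 f) :=
    VectorFourier.fourierIntegral_continuous Real.continuous_fourierChar
      (by exact continuous_inner) hf
  have := Measure.map_addHaar_smul (volume : Measure E) (inv_ne_zero hpi)
  have h2 : ∫⁻ ξ : E, ‖𝓕 f ((2 * Real.pi)⁻¹ • ξ)‖ₑ ^ 2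
      = ∫⁻ ξ, ‖𝓕 f ξ‖ₑ ^ 2 ∂(Measure.map ((2 * Real.pi)⁻¹ • ·) volume) := by
    rw [lintegral_map (by fun_prop) (by fun_prop)]
  rw [h2, this, lintegral_smul_measure, lintegral_enorm_sq_fourier hf hf2, smul_eq_mul]
  gcongr
  rw [inv_pow, inv_inv, abs_of_pos (by positivity)]
  rfl

end Plancherel

/-! ### Decay of the Fourier transform of the sphere, from Bessel's equation. -/

section Decay

theorem norm_exp_neg_I_mul (r : ℝ) : ‖Complex.exp (-Complex.I * r)‖ = 1 := by
  rw [neg_mul, mul_comm, ← neg_mul, ← Complex.ofReal_neg, Complex.norm_exp_ofReal_mul_I]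

-- Used with `p` and `q` coordinates of a unit vector, this supplies the derivatives of the
-- spherical wave along lines.
open Complex in
theorem hasDerivAt_integral_exp_affine {Ω : Type*} [MeasurableSpace Ω] (μ : Measure Ω)
    [IsFiniteMeasure μ] {a : Ω → ℂ} {p q : Ω → ℝ} (ha : Measurable a) (hp : Measurable p)
    (hq : Measurable q) (ha1 : ∀ x, ‖a x‖ ≤ 1) (hq1 : ∀ x, |q x| ≤ 1) (t : ℝ) :
    HasDerivAt (fun t : ℝ => ∫ x, a x * cexp (-I * (p x + t * q x : ℝ)) ∂μ)
      (∫ x, a x * (-I * q x) * cexp (-I * (p x + t * q x : ℝ)) ∂μ) t := by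
  have hn := norm_exp_neg_I_mul
  refine (hasDerivAt_integral_of_dominated_loc_of_deriv_le (F := fun (t : ℝ) x =>
    a x * cexp (-I * (p x + t * q x : ℝ)))
    (F' := fun (t : ℝ) x => a x * (-I * q x) * cexp (-I * (p x + t * q x : ℝ)))
    (bound := fun _ => 1) (s := Set.univ) Filter.univ_mem ?_ ?_ ?_ ?_ ?_ ?_).2
  · refine .of_forall fun t => Measurable.aestronglyMeasurable ?_
    fun_prop
  · refine Integrable.of_bound (C := 1) (Measurable.aestronglyMeasurable (by fun_prop)) ?_
    refine .of_forall fun x => ?_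
    rw [norm_mul, hn, mul_one]; exact ha1 x
  · exact Measurable.aestronglyMeasurable (by fun_prop)
  · refine .of_forall fun x t _ => ?_
    rw [norm_mul, hn, mul_one, norm_mul, norm_mul, norm_neg, norm_I, one_mul, norm_real]
    exact mul_le_one₀ (ha1 x) (norm_nonneg _) (hq1 x)
  · exact integrable_const _
  · refine .of_forall fun x t _ => ?_
    have h1 : HasDerivAt (fun t : ℝ => ((p x + t * q x : ℝ) : ℂ)) (q x : ℂ) t := by
      have : HasDerivAt (fun t : ℝ => p x + t * q x) (q x) t := by
        simpa using ((hasDerivAt_id t).mul_const (q x)).const_add (p x)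
      exact this.ofReal_comp
    have h2 := ((h1.const_mul (-I)).cexp).const_mul (a x)
    exact h2.congr_deriv (by ring)

/-- Solutions of `v'' = (c / s²  - 1) v` are bounded on `[1, ∞)`. -/
theorem exists_norm_le_of_hasDerivAt_perturbed_oscillator {v v' : ℝ → ℂ} {c : ℝ}
    (h1 : ∀ s, 0 < s → HasDerivAt v (v' s) s)
    (h2 : ∀ s, 0 < s → HasDerivAt v' (((c / s ^ 2 - 1 : ℝ) : ℂ) * v s) s) :
    ∃ C, ∀ s, 1 ≤ s → ‖v s‖ ≤ C := by
  -- The energy `‖v‖² + ‖v'‖²` grows at relative rate at most `|c| / s²`. The weight decays at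
  -- exactly this rate, so `G` is antitone, and the weight is at least `1`.
  set G : ℝ → ℝ := fun s => (‖v s‖ ^ 2 + ‖v' s‖ ^ 2) * Real.exp (|c| * s⁻¹) with hG
  have hd : ∀ s, 0 < s → HasDerivAt G
      ((2 * inner ℝ (v s) (v' s) + 2 * inner ℝ (v' s) (((c / s ^ 2 - 1 : ℝ) : ℂ) * v s))
          * Real.exp (|c| * s⁻¹)
        + (‖v s‖ ^ 2 + ‖v' s‖ ^ 2) * (Real.exp (|c| * s⁻¹) * (|c| * (-(s ^ 2)⁻¹)))) s :=
    fun s hs => ((h1 s hs).norm_sq.add (h2 s hs).norm_sq).mul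
      (((hasDerivAt_inv hs.ne').const_mul |c|).exp)
  have hanti : AntitoneOn G (Set.Ici 1) := by
    refine antitoneOn_of_deriv_nonpos (convex_Ici 1)
      (fun s hs => (hd s (lt_of_lt_of_le one_pos hs)).continuousAt.continuousWithinAt) ?_ ?_
    · intro s hs
      rw [interior_Ici] at hs
      exact (hd s (one_pos.trans hs)).differentiableAt.differentiableWithinAt
    · intro s hs
      rw [interior_Ici] at hs
      have hs0 : 0 < s := one_pos.trans hs
      rw [(hd s hs0).deriv]
      have e1 : inner ℝ (v' s) (((c / s ^ 2 - 1 : ℝ) : ℂ) * v s)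
          = (c / s ^ 2 - 1) * inner ℝ (v s) (v' s) := by
        rw [← Complex.real_smul, inner_smul_right, real_inner_comm]
      rw [e1]
      have e2 : c * (2 * inner ℝ (v s) (v' s)) ≤ |c| * (‖v s‖ ^ 2 + ‖v' s‖ ^ 2) := by
        refine (le_abs_self _).trans ?_
        rw [abs_mul]
        gcongr
        have := abs_real_inner_le_norm (v s) (v' s)
        rw [abs_mul, abs_two]
        nlinarith [sq_nonneg (‖v s‖ - ‖v' s‖)]
      have e3 : (2 * inner ℝ (v s) (v' s) + 2 * ((c / s ^ 2 - 1) * inner ℝ (v s) (v' s)))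
          * Real.exp (|c| * s⁻¹)
        + (‖v s‖ ^ 2 + ‖v' s‖ ^ 2) * (Real.exp (|c| * s⁻¹) * (|c| * (-(s ^ 2)⁻¹)))
        = -((|c| * (‖v s‖ ^ 2 + ‖v' s‖ ^ 2) - c * (2 * inner ℝ (v s) (v' s)))
            * ((s ^ 2)⁻¹ * Real.exp (|c| * s⁻¹))) := by
        field_simp; ring
      rw [e3, neg_nonpos]
      exact mul_nonneg (sub_nonneg.2 e2) (by positivity)
  refine ⟨√(G 1), fun s hs => Real.le_sqrt_of_sq_le ?_⟩
  refine le_trans ?_ (hanti (Set.mem_Ici.2 le_rfl) (Set.mem_Ici.2 hs) hs)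
  have : 1 ≤ Real.exp (|c| * s⁻¹) := Real.one_le_exp (by positivity)
  simp only [hG]
  nlinarith [sq_nonneg ‖v' s‖, sq_nonneg ‖v s‖]

/-- Solutions of the Bessel type equation `U'' + (2a/s) U' + U = 0` are `O(s^{-a})`. -/
theorem exists_norm_le_rpow_of_hasDerivAt {U U' U'' : ℝ → ℂ} {a : ℝ}
    (h1 : ∀ s, 0 < s → HasDerivAt U (U' s) s) (h2 : ∀ s, 0 < s → HasDerivAt U' (U'' s) s)
    (hode : ∀ s : ℝ, 0 < s → U'' s = -U s - ((2 * a / s : ℝ) : ℂ) * U' s) :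
    ∃ C, ∀ s, 1 ≤ s → ‖U s‖ ≤ C * s ^ (-a) := by
  have hpow : ∀ b s : ℝ, 0 < s → HasDerivAt (fun s : ℝ => ((s ^ b : ℝ) : ℂ))
      ((b * s ^ (b - 1) : ℝ) : ℂ) s := fun b s hs =>
    (Real.hasDerivAt_rpow_const (Or.inl hs.ne')).ofReal_comp
  -- The substitution `v = s^a U` removes the first order term and leaves the potential `a(a-1)/s²`.
  obtain ⟨C, hC⟩ := exists_norm_le_of_hasDerivAt_perturbed_oscillator
    (v := fun s => ((s ^ a : ℝ) : ℂ) * U s)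
    (v' := fun s => ((a * s ^ (a - 1) : ℝ) : ℂ) * U s + ((s ^ a : ℝ) : ℂ) * U' s)
    (c := a * (a - 1)) (fun s hs => (hpow a s hs).mul (h1 s hs)) (fun s hs => by
      have e := ((((hpow (a - 1) s hs).const_mul (a : ℂ)).mul (h1 s hs)).add
        ((hpow a s hs).mul (h2 s hs)))
      have e' : HasDerivAt (fun s => ((a * s ^ (a - 1) : ℝ) : ℂ) * U s + ((s ^ a : ℝ) : ℂ) * U' s)
        _ s := e.congr_of_eventuallyEq (.of_forall fun x => by push_cast; rfl)
      convert e' using 1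
      rw [hode s hs]
      have r1 : s ^ (a - 1) = s ^ a / s := Real.rpow_sub_one hs.ne' a
      have r2 : s ^ (a - 1 - 1) = s ^ a / s / s := by
        rw [Real.rpow_sub_one hs.ne', Real.rpow_sub_one hs.ne']
      rw [r1, r2]
      have : (s : ℂ) ≠ 0 := by exact_mod_cast hs.ne'
      push_cast
      field_simp
      ring)
  refine ⟨C, fun s hs => ?_⟩
  have hs0 : 0 < s := one_pos.trans_le hs
  have := hC s hs
  rw [norm_mul, Complex.norm_real, Real.norm_of_nonneg (by positivity)] at this
  rw [Real.rpow_neg hs0.le, ← div_eq_mul_inv, le_div_iff₀ (by positivity), mul_comm]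
  exact this

open Complex in
/-- The average of the plane wave `e^{-i⟨w, ·⟩}` over the unit sphere, up to a constant factor. -/
noncomputable def sphericalWave {Y : Type*} [NormedAddCommGroup Y] [InnerProductSpace ℝ Y]
    [MeasureSpace Y] (w : Y) : ℂ :=
  ∫ x : Y in Metric.ball 0 1, cexp (-I * ((inner ℝ w (‖x‖⁻¹ • x) : ℝ) : ℂ))

/-- Vectors of the same norm are related by a linear isometry. -/
theorem exists_linearIsometryEquiv_apply_eq {Y : Type*} [NormedAddCommGroup Y]
    [InnerProductSpace ℝ Y] {v w : Y} (h : ‖v‖ = ‖w‖) : ∃ V : Y ≃ₗᵢ[ℝ] Y, V v = w :=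
  ⟨(ℝ ∙ (v - w))ᗮ.reflection, Submodule.reflection_sub h⟩

variable {Y : Type*} [NormedAddCommGroup Y] [InnerProductSpace ℝ Y] [FiniteDimensional ℝ Y]
  [MeasurableSpace Y] [BorelSpace Y]

theorem sphericalWave_map (V : Y ≃ₗᵢ[ℝ] Y) (w : Y) :
    sphericalWave (V w) = sphericalWave w := by
  have h := V.measurePreserving.setIntegral_preimage_emb V.toMeasurableEquiv.measurableEmbedding
    (fun x => Complex.exp (-Complex.I * ((inner ℝ (V w) (‖x‖⁻¹ • x) : ℝ) : ℂ))) (Metric.ball 0 1)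
  have hb : V ⁻¹' Metric.ball 0 1 = Metric.ball 0 1 := by ext x; simp
  rw [hb] at h
  rw [sphericalWave, ← h, sphericalWave]
  refine integral_congr_ae (.of_forall fun x => ?_)
  simp only [V.norm_map, ← map_smul, V.inner_map_map]

theorem sphericalWave_eq_of_norm_eq {v w : Y} (h : ‖v‖ = ‖w‖) :
    sphericalWave v = sphericalWave w := by
  obtain ⟨V, rfl⟩ := exists_linearIsometryEquiv_apply_eq h
  rw [sphericalWave_map]

theorem measurable_unit_inner (e : Y) : Measurable fun x : Y => inner ℝ e (‖x‖⁻¹ • x) := by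
  fun_prop

theorem abs_inner_unit_le {Y : Type*} [NormedAddCommGroup Y] [InnerProductSpace ℝ Y] {e : Y}
    (he : ‖e‖ = 1) (x : Y) : |inner ℝ e (‖x‖⁻¹ • x)| ≤ 1 := by
  refine (abs_real_inner_le_norm _ _).trans ?_
  rw [he, one_mul, norm_smul, norm_inv, norm_norm]
  exact inv_mul_le_one

-- The spherical wave is radial and, as a superposition of plane waves with unit frequencies, solves
-- `Δu = -u`. Along the ray through `b 0` this is a Bessel type equation with `2a = n - 1`.
open Complex in
theorem exists_norm_sphericalWave_le (n : ℕ) (hn : Module.finrank ℝ Y = n) (hn1 : 1 ≤ n) :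
    ∃ C : ℝ, ∀ w : Y, 1 ≤ ‖w‖ → ‖sphericalWave w‖ ≤ C * ‖w‖ ^ (-(((n : ℝ) - 1) / 2)) := by
  obtain ⟨k, rfl⟩ : ∃ k, n = k + 1 := ⟨n - 1, by omega⟩
  let b : OrthonormalBasis (Fin (k + 1)) ℝ Y := (stdOrthonormalBasis ℝ Y).reindex (finCongr hn)
  set μ : Measure Y := volume.restrict (Metric.ball 0 1) with hμ
  have : IsFiniteMeasure μ := ⟨by
    rw [hμ, Measure.restrict_apply_univ]; exact measure_ball_lt_top⟩
  set q : Fin (k + 1) → Y → ℝ := fun j x => inner ℝ (b j) (‖x‖⁻¹ • x) with hq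
  have hqm : ∀ j, Measurable (q j) := fun j => measurable_unit_inner _
  have hq1 : ∀ j x, |q j x| ≤ 1 := fun j x => abs_inner_unit_le (b.orthonormal.1 j) x
  have hsum : ∀ x, x ≠ 0 → ∑ j, (q j x) ^ 2 = 1 := by
    intro x hx
    simp only [hq]
    rw [b.sum_sq_inner_right, norm_smul, norm_inv, norm_norm,
      inv_mul_cancel₀ (norm_ne_zero_iff.2 hx), one_pow]
  set U : ℝ → ℂ := fun s => ∫ x, cexp (-I * (s * q 0 x : ℝ)) ∂μ with hU
  set U' : ℝ → ℂ := fun s => ∫ x, (-I * q 0 x) * cexp (-I * (s * q 0 x : ℝ)) ∂μ with hU'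
  set D : Fin (k + 1) → ℝ → ℂ := fun j s =>
    ∫ x, (-I * q j x) * (-I * q j x) * cexp (-I * (s * q 0 x : ℝ)) ∂μ with hD
  have hIq : ∀ j x, ‖-I * (q j x : ℂ)‖ ≤ 1 := fun j x => by
    rw [norm_mul, norm_neg, norm_I, one_mul, norm_real]; exact hq1 j x
  have hIm : ∀ j, Measurable fun x => -I * (q j x : ℂ) := fun j => by
    have := hqm j; fun_prop
  have dU : ∀ s, HasDerivAt U (U' s) s := fun s => by
    have := hasDerivAt_integral_exp_affine μ (a := fun _ => 1) (p := fun _ => 0)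
      measurable_const measurable_const (hqm 0) (by simp) (hq1 0) s
    simpa only [zero_add, one_mul] using this
  have dU' : ∀ s, HasDerivAt U' (D 0 s) s := fun s => by
    have := hasDerivAt_integral_exp_affine μ (a := fun x => -I * q 0 x) (p := fun _ => 0)
      (hIm 0) measurable_const (hqm 0) (hIq 0) (hq1 0) s
    simpa only [zero_add] using this
  -- Radiality, read in the plane spanned by `b 0` and `b j`.
  have hline : ∀ j, j ≠ 0 → ∀ s t : ℝ, 0 < s →
      ∫ x, cexp (-I * (s * q 0 x + t * q j x : ℝ)) ∂μ = U (√(s ^ 2 + t ^ 2)) := by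
    intro j hj s t hs
    have horth : inner ℝ (b 0) (b j) = 0 := b.orthonormal.2 hj.symm
    have hnorm : ‖s • b 0 + t • b j‖ = ‖√(s ^ 2 + t ^ 2) • b 0‖ := by
      rw [norm_smul, b.orthonormal.1 0, mul_one, Real.norm_of_nonneg (Real.sqrt_nonneg _)]
      refine (Real.sqrt_eq_iff_mul_self_eq (by positivity) (norm_nonneg _)).2 ?_ |>.symm
      rw [norm_add_mul_self_real, inner_smul_left, inner_smul_right, horth, norm_smul, norm_smul,
        b.orthonormal.1, b.orthonormal.1]
      simp only [mul_one, mul_zero, add_zero, Real.norm_eq_abs, abs_mul_abs_self]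
      ring
    have := sphericalWave_eq_of_norm_eq hnorm
    simp only [sphericalWave, inner_add_left, inner_smul_left, conj_trivial] at this
    exact this
  -- The second derivative of a radial function across the ray is `U'(s)/s`. It is obtained by
  -- differentiating `hline` twice in `t` at `t = 0`, under the integral on one side and by the
  -- chain rule on the other.
  have hDj : ∀ j, j ≠ 0 → ∀ s : ℝ, 0 < s → D j s = ((s⁻¹ : ℝ) : ℂ) * U' s := by
    intro j hj s hs
    have hr : ∀ t : ℝ, 0 < s ^ 2 + t ^ 2 := fun t => by positivity
    have dr : ∀ t : ℝ, HasDerivAt (fun t : ℝ => √(s ^ 2 + t ^ 2)) (t / √(s ^ 2 + t ^ 2)) t := by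
      intro t
      have := (((hasDerivAt_id t).pow 2).const_add (s ^ 2)).sqrt (hr t).ne'
      refine this.congr_deriv ?_
      have h : √(s ^ 2 + t ^ 2) ≠ 0 := (Real.sqrt_pos.2 (hr t)).ne'
      simp only [id, Pi.pow_apply]
      field_simp
      norm_num
    have first : ∀ t : ℝ, ∫ x, (-I * q j x) * cexp (-I * (s * q 0 x + t * q j x : ℝ)) ∂μ
        = ((t / √(s ^ 2 + t ^ 2) : ℝ) : ℂ) * U' (√(s ^ 2 + t ^ 2)) := by
      intro t
      have a1 := hasDerivAt_integral_exp_affine μ (a := fun _ => 1) (p := fun x => s * q 0 x)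
        measurable_const ((hqm 0).const_mul s) (hqm j) (by simp) (hq1 j) t
      simp only [one_mul, hline j hj s _ hs] at a1
      have a2 := (dU (√(s ^ 2 + t ^ 2))).scomp t (dr t)
      rw [Complex.real_smul] at a2
      exact a1.unique a2
    have b1 := hasDerivAt_integral_exp_affine μ (a := fun x => -I * q j x)
      (p := fun x => s * q 0 x) (hIm j) ((hqm 0).const_mul s) (hqm j) (hIq j) (hq1 j) 0
    simp only [first, zero_mul, add_zero] at b1
    have b2 : HasDerivAt (fun t : ℝ => ((t / √(s ^ 2 + t ^ 2) : ℝ) : ℂ)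
        * U' (√(s ^ 2 + t ^ 2))) (((s⁻¹ : ℝ) : ℂ) * U' s) 0 := by
      have h0 : √(s ^ 2 + 0 ^ 2) = s := by
        rw [zero_pow two_ne_zero, add_zero, Real.sqrt_sq hs.le]
      have c1 := ((hasDerivAt_id (0 : ℝ)).div (dr 0) (by rw [h0]; exact hs.ne')).ofReal_comp
      have c2 := (dU' (√(s ^ 2 + 0 ^ 2))).scomp 0 (dr 0)
      have c3 := c1.mul c2
      simp only [id, h0, zero_div, zero_smul, mul_zero, add_zero, sub_zero, one_mul] at c3
      refine c3.congr_deriv ?_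
      have : (U' ∘ fun t => √(s ^ 2 + t ^ 2)) 0 = U' s := congrArg U' h0
      rw [this]
      congr 2
      field_simp
    exact b1.unique b2
  have hint : ∀ j s, Integrable (fun x => (-I * q j x) * (-I * q j x)
      * cexp (-I * (s * q 0 x : ℝ))) μ := by
    intro j s
    have := hqm 0
    have := hqm j
    refine Integrable.of_bound (C := 1) (Measurable.aestronglyMeasurable (by fun_prop))
      (.of_forall fun x => ?_)
    rw [norm_mul, norm_mul, norm_exp_neg_I_mul, mul_one]
    exact mul_le_one₀ (hIq j x) (norm_nonneg _) (hIq j x)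
  -- The equation `Δu = -u`: away from the origin the `q j` are the coordinates of a unit vector.
  have htot : ∀ s, ∑ j, D j s = -U s := by
    intro s
    simp only [hD, hU]
    rw [← integral_finsetSum _ fun j _ => hint j s, ← integral_neg]
    refine integral_congr_ae ?_
    have hne : ∀ᵐ x ∂μ, x ≠ 0 := by
      have : Nontrivial Y := Module.nontrivial_of_finrank_pos (R := ℝ) (by omega)
      refine ae_restrict_of_ae ?_
      rw [ae_iff]
      simp
    filter_upwards [hne] with x hx
    rw [← Finset.sum_mul]
    have : ∑ j, (-I * (q j x : ℂ)) * (-I * q j x) = -1 := by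
      have h := congrArg (fun r : ℝ => (r : ℂ)) (hsum x hx)
      push_cast at h
      rw [← h, ← Finset.sum_neg_distrib]
      refine Finset.sum_congr rfl fun j _ => ?_
      linear_combination (q j x : ℂ) ^ 2 * I_sq
    rw [this]; ring
  obtain ⟨C, hC⟩ := exists_norm_le_rpow_of_hasDerivAt (U := U) (U' := U') (U'' := D 0)
    (a := (k : ℝ) / 2) (fun s _ => dU s) (fun s _ => dU' s) (by
      intro s hs
      have h := htot s
      rw [Fin.sum_univ_succ, Finset.sum_congr rfl fun j _ => hDj j.succ (Fin.succ_ne_zero j) s hs,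
        Finset.sum_const, Finset.card_univ, Fintype.card_fin, nsmul_eq_mul] at h
      rw [← h]
      push_cast
      ring)
  refine ⟨C, fun w hw => ?_⟩
  have hw' : ‖w‖ = ‖‖w‖ • b 0‖ := by
    rw [norm_smul, b.orthonormal.1 0, mul_one, norm_norm]
  rw [sphericalWave_eq_of_norm_eq hw']
  have := hC ‖w‖ hw
  push_cast
  rw [add_sub_cancel_right]
  refine le_trans (le_of_eq ?_) this
  simp only [sphericalWave, inner_smul_left, conj_trivial]
  rfl

end Decay

/-! ### Bounds for the spherical wave at all frequencies. -/

section SphericalWaveBounds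

variable {Y : Type*} [NormedAddCommGroup Y] [InnerProductSpace ℝ Y] [FiniteDimensional ℝ Y]
  [MeasurableSpace Y] [BorelSpace Y]

theorem norm_sphericalWave_le (w : Y) :
    ‖sphericalWave w‖ ≤ volume.real (Metric.ball (0 : Y) 1) := by
  have : IsFiniteMeasure (volume.restrict (Metric.ball (0 : Y) 1)) :=
    isFiniteMeasure_restrict.2 measure_ball_lt_top.ne
  refine (norm_integral_le_of_norm_le_const (C := 1) (.of_forall fun x => ?_)).trans ?_
  · rw [norm_exp_neg_I_mul]
  · rw [one_mul, measureReal_restrict_apply_univ]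

theorem stronglyMeasurable_sphericalWave : StronglyMeasurable (sphericalWave : Y → ℂ) := by
  refine StronglyMeasurable.integral_prod_right (f := fun (w x : Y) =>
    Complex.exp (-Complex.I * ((inner ℝ w (‖x‖⁻¹ • x) : ℝ) : ℂ))) ?_
  refine Measurable.stronglyMeasurable ?_
  unfold Function.uncurry
  fun_prop

/-- Decay of the spherical wave, with any exponent up to the optimal one. -/
theorem exists_norm_sphericalWave_le_rpow {n : ℕ} (hn : Module.finrank ℝ Y = n) (hn1 : 1 ≤ n) :
    ∃ C : ℝ≥0, ∀ a : ℝ, 0 ≤ a → a ≤ ((n : ℝ) - 1) / 2 →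
      ∀ w : Y, w ≠ 0 → ‖sphericalWave w‖ ≤ C * ‖w‖ ^ (-a) := by
  obtain ⟨C, hC⟩ := exists_norm_sphericalWave_le (Y := Y) n hn hn1
  -- For `‖w‖ ≥ 1` a smaller exponent is weaker than the optimal one; for `‖w‖ ≤ 1` the power is at
  -- least `1` and the trivial bound by the volume of the ball suffices.
  refine ⟨(max C (volume.real (Metric.ball (0 : Y) 1))).toNNReal, fun a ha han w hw => ?_⟩
  have hw0 : 0 < ‖w‖ := norm_pos_iff.2 hw
  rw [Real.coe_toNNReal _ (le_max_of_le_right measureReal_nonneg)]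
  rcases le_total 1 ‖w‖ with h | h
  · refine (hC w h).trans ?_
    refine mul_le_mul (le_max_left _ _) (Real.rpow_le_rpow_of_exponent_le h (by linarith))
      (by positivity) (le_max_of_le_right measureReal_nonneg)
  · refine (norm_sphericalWave_le w).trans ?_
    have h1 : 1 ≤ ‖w‖ ^ (-a) := Real.one_le_rpow_of_pos_of_le_one_of_nonpos hw0 h (by linarith)
    refine (le_max_right C _).trans (le_mul_of_one_le_right ?_ h1)
    exact le_max_of_le_right measureReal_nonneg

/-- The weight cancels the Jacobian `r^(n-1)` of polar coordinates, hence the linear growth in `S`.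
-/
theorem lintegral_ball_norm_rpow {n : ℕ} (hn : Module.finrank ℝ Y = n) (hn1 : 1 ≤ n) {S : ℝ}
    (hS : 0 < S) :
    ∫⁻ y in Metric.ball (0 : Y) S, ENNReal.ofReal (‖y‖ ^ (-((n : ℝ) - 1)))
      = ENNReal.ofReal (n * volume.real (Metric.ball (0 : Y) 1) * S) := by
  have : Nontrivial Y := Module.nontrivial_of_finrank_pos (R := ℝ) (by omega)
  have hpow : ∀ r : ℝ, 0 < r → r ^ (n - 1) * r ^ (-((n : ℝ) - 1)) = 1 := by
    intro r hr
    rw [← Real.rpow_natCast, ← Real.rpow_add hr, Nat.cast_sub hn1]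
    simp
  have hint : IntegrableOn (fun y : Y => ‖y‖ ^ (-((n : ℝ) - 1))) (Metric.ball 0 S) := by
    rw [integrableOn_fun_norm_addHaar (E := Y) volume (f := fun r => r ^ (-((n : ℝ) - 1))), hn]
    refine (integrableOn_congr_fun (g := fun _ => (1 : ℝ)) (fun r hr => ?_)
      measurableSet_Ioo).2 ?_
    · exact hpow r hr.1
    · exact integrableOn_const (by simp)
  rw [← ofReal_integral_eq_lintegral_ofReal hint (.of_forall fun y => by positivity)]
  congr 1
  have e : ∀ y : Y, (Metric.ball (0 : Y) S).indicator (fun y => ‖y‖ ^ (-((n : ℝ) - 1))) y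
      = (Set.Iio S).indicator (fun r : ℝ => r ^ (-((n : ℝ) - 1))) ‖y‖ := by
    intro y
    simp only [Set.indicator, Metric.mem_ball, dist_zero_right, Set.mem_Iio]
  rw [← integral_indicator Metric.isOpen_ball.measurableSet]
  simp_rw [e]
  rw [integral_fun_norm_addHaar (E := Y) volume
    (f := (Set.Iio S).indicator (fun r : ℝ => r ^ (-((n : ℝ) - 1)))), hn]
  have : ∫ y in Set.Ioi (0 : ℝ),
      y ^ (n - 1) • (Set.Iio S).indicator (fun r : ℝ => r ^ (-((n : ℝ) - 1))) y = S := by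
    rw [setIntegral_congr_fun (g := (Set.Iio S).indicator fun _ => (1 : ℝ)) measurableSet_Ioi]
    · rw [setIntegral_indicator measurableSet_Iio]
      simp [Set.Ioi_inter_Iio, hS.le]
    · intro r hr
      by_cases h : r < S
      · simpa [h] using hpow r hr
      · simp [h]
  rw [this]
  simp only [nsmul_eq_mul, smul_eq_mul]
  ring

end SphericalWaveBounds

/-! ### Averaging the Fourier integral over rotations of the second block. -/

section WaveIntegral

variable {X Y : Type*} [NormedAddCommGroup X] [InnerProductSpace ℝ X] [FiniteDimensional ℝ X]
  [MeasurableSpace X] [BorelSpace X]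
  [NormedAddCommGroup Y] [InnerProductSpace ℝ Y] [FiniteDimensional ℝ Y]
  [MeasurableSpace Y] [BorelSpace Y]

/-- The Fourier integral on the orthogonal sum of two Euclidean spaces. -/
noncomputable def waveIntegral {X Y : Type*} [NormedAddCommGroup X] [InnerProductSpace ℝ X]
    [MeasureSpace X] [NormedAddCommGroup Y] [InnerProductSpace ℝ Y] [MeasureSpace Y]
    (g : X × Y → ℂ) (ξ : X × Y) : ℂ :=
  ∫ p : X × Y, g p * Complex.exp (-Complex.I * ((inner ℝ ξ.1 p.1 + inner ℝ ξ.2 p.2 : ℝ) : ℂ))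

theorem waveIntegral_map_snd {g : X × Y → ℂ} (V : Y ≃ₗᵢ[ℝ] Y)
    (hg : ∀ x y, g (x, V y) = g (x, y)) (ξ : X × Y) :
    waveIntegral g (ξ.1, V ξ.2) = waveIntegral g ξ := by
  have hV : MeasurePreserving (Prod.map id V : X × Y → X × Y) :=
    (MeasurePreserving.id volume).prod V.measurePreserving
  have hVe : MeasurableEmbedding (Prod.map id V : X × Y → X × Y) :=
    MeasurableEmbedding.id.prodMap V.toMeasurableEquiv.measurableEmbedding
  rw [waveIntegral, ← hV.integral_comp hVe, waveIntegral]
  refine integral_congr_ae (.of_forall fun p => ?_)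
  simp only [Prod.map_fst, Prod.map_snd, id, V.inner_map_map]
  congr 1
  exact hg p.1 p.2

/-- By symmetry the transform is unchanged when `ξ.2` is turned in the direction of any nonzero `w`.
Integrating over `w` in the unit ball and applying Fubini puts the average on the plane wave. The
volume factor appears because `sphericalWave` is not normalised. -/
theorem volume_ball_mul_waveIntegral [Nontrivial Y] {g : X × Y → ℂ} (hg : Integrable g)
    (hsym : ∀ (V : Y ≃ₗᵢ[ℝ] Y) (x y), g (x, V y) = g (x, y)) (ξ : X × Y) :
    (volume.real (Metric.ball (0 : Y) 1) : ℂ) * waveIntegral g ξ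
      = ∫ p : X × Y, g p * Complex.exp (-Complex.I * ((inner ℝ ξ.1 p.1 : ℝ) : ℂ))
          * sphericalWave (‖ξ.2‖ • p.2) := by
  set μ : Measure Y := volume.restrict (Metric.ball 0 1) with hμ
  have : IsFiniteMeasure μ := ⟨by
    rw [hμ, Measure.restrict_apply_univ]; exact measure_ball_lt_top⟩
  have hconst : ∀ᵐ w ∂μ, waveIntegral g (ξ.1, ‖ξ.2‖ • (‖w‖⁻¹ • w)) = waveIntegral g ξ := by
    have hne : ∀ᵐ w ∂μ, w ≠ 0 := ae_restrict_of_ae (by rw [ae_iff]; simp)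
    filter_upwards [hne] with w hw
    obtain ⟨V, hV⟩ := exists_linearIsometryEquiv_apply_eq (v := ξ.2)
      (w := ‖ξ.2‖ • (‖w‖⁻¹ • w)) (by
        rw [norm_smul, norm_smul, norm_inv, norm_norm, norm_norm,
          inv_mul_cancel₀ (norm_ne_zero_iff.2 hw), mul_one])
    rw [← hV]
    exact waveIntegral_map_snd V (hsym V) ξ
  have h1 : ∫ w, waveIntegral g (ξ.1, ‖ξ.2‖ • (‖w‖⁻¹ • w)) ∂μ
      = (volume.real (Metric.ball (0 : Y) 1) : ℂ) * waveIntegral g ξ := by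
    rw [integral_congr_ae hconst, integral_const, hμ, measureReal_restrict_apply_univ,
      Complex.real_smul]
  rw [← h1]
  simp only [waveIntegral]
  rw [integral_integral_swap]
  · refine integral_congr_ae (.of_forall fun p => ?_)
    simp only [sphericalWave]
    rw [← integral_const_mul]
    refine integral_congr_ae (.of_forall fun w => ?_)
    simp only
    have e : inner ℝ (‖ξ.2‖ • ‖w‖⁻¹ • w) p.2 = inner ℝ (‖ξ.2‖ • p.2) (‖w‖⁻¹ • w) := by
      rw [real_inner_smul_left, real_inner_smul_left, real_inner_smul_left, real_inner_smul_right,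
        real_inner_comm]
    rw [mul_assoc, ← Complex.exp_add, e]
    push_cast
    ring_nf
  · have hgp : Integrable (fun z : Y × (X × Y) => g z.2) (μ.prod volume) := by
      simpa using (integrable_const (1 : ℂ)).mul_prod (μ := μ) hg
    refine (hgp.mul_bdd (c := 1) (g := fun z : Y × (X × Y) => Complex.exp (-Complex.I *
      ((inner ℝ ξ.1 z.2.1 + inner ℝ (‖ξ.2‖ • (‖z.1‖⁻¹ • z.1)) z.2.2 : ℝ) : ℂ))) ?_ ?_)
    · exact Measurable.aestronglyMeasurable (by fun_prop)
    · exact .of_forall fun z => (norm_exp_neg_I_mul _).le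

end WaveIntegral

theorem lintegral_mul_sq_le {α : Type*} [MeasurableSpace α] (μ : Measure α) {f g : α → ℝ≥0∞}
    (hf : AEMeasurable f μ) (hg : AEMeasurable g μ) :
    (∫⁻ x, f x * g x ∂μ) ^ 2 ≤ (∫⁻ x, f x ^ 2 ∂μ) * ∫⁻ x, g x ^ 2 ∂μ := by
  have h := ENNReal.lintegral_mul_le_Lp_mul_Lq μ Real.HolderConjugate.two_two hf hg
  simp only [Pi.mul_apply, ENNReal.rpow_two] at h
  refine (pow_le_pow_left₀ zero_le h 2).trans (le_of_eq ?_)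
  rw [mul_pow, ← ENNReal.rpow_two, ← ENNReal.rpow_two, ← ENNReal.rpow_mul, ← ENNReal.rpow_mul]
  norm_num

/-! ### The uniform bound for the far part and the `L²` bound for the near part. -/

section WaveIntegralEstimates

variable {X Y : Type*} [NormedAddCommGroup X] [InnerProductSpace ℝ X] [FiniteDimensional ℝ X]
  [MeasurableSpace X] [BorelSpace X]
  [NormedAddCommGroup Y] [InnerProductSpace ℝ Y] [FiniteDimensional ℝ Y]
  [MeasurableSpace Y] [BorelSpace Y]

theorem waveIntegral_congr_ae {g g' : X × Y → ℂ} (h : g =ᵐ[volume] g') :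
    waveIntegral g = waveIntegral g' := by
  funext ξ
  refine integral_congr_ae ?_
  filter_upwards [h] with p hp
  rw [hp]

theorem integrable_mul_wave {g : X × Y → ℂ} (hg : Integrable g) (ξ : X × Y) :
    Integrable fun p => g p *
      Complex.exp (-Complex.I * ((inner ℝ ξ.1 p.1 + inner ℝ ξ.2 p.2 : ℝ) : ℂ)) :=
  hg.mul_bdd (c := 1) (Measurable.aestronglyMeasurable (by fun_prop))
    (.of_forall fun z => (norm_exp_neg_I_mul _).le)

theorem waveIntegral_add {g h : X × Y → ℂ} (hg : Integrable g) (hh : Integrable h)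
    (ξ : X × Y) : waveIntegral (g + h) ξ = waveIntegral g ξ + waveIntegral h ξ := by
  simp only [waveIntegral]
  rw [← integral_add (integrable_mul_wave hg ξ) (integrable_mul_wave hh ξ)]
  simp only [Pi.add_apply, add_mul]

theorem stronglyMeasurable_waveIntegral {g : X × Y → ℂ} (hg : AEStronglyMeasurable g volume) :
    StronglyMeasurable (waveIntegral g) := by
  rw [waveIntegral_congr_ae hg.ae_eq_mk]
  refine StronglyMeasurable.integral_prod_right (f := fun (ξ p : X × Y) => hg.mk g p *
    Complex.exp (-Complex.I * ((inner ℝ ξ.1 p.1 + inner ℝ ξ.2 p.2 : ℝ) : ℂ))) ?_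
  refine StronglyMeasurable.mul (hg.stronglyMeasurable_mk.comp_measurable measurable_snd) ?_
  exact Measurable.stronglyMeasurable (by fun_prop)

theorem volume_ball_pos_toNNReal [Nontrivial Y] :
    0 < (volume.real (Metric.ball (0 : Y) 1)).toNNReal :=
  Real.toNNReal_pos.2
    (ENNReal.toReal_pos (Metric.measure_ball_pos _ _ one_pos).ne' measure_ball_lt_top.ne)

theorem enorm_volume_ball_mul (z : ℂ) :
    ‖(volume.real (Metric.ball (0 : Y) 1) : ℂ) * z‖ₑ
      = (volume.real (Metric.ball (0 : Y) 1)).toNNReal * ‖z‖ₑ := by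
  rw [enorm_mul, ← ofReal_norm, Complex.norm_real, Real.norm_of_nonneg measureReal_nonneg]
  rfl

/-- Uniform bound for the Fourier integral of a function that is rotation invariant in the second
variable and lives where that variable is large. -/
theorem exists_enorm_waveIntegral_le_of_tail {n m : ℕ} (hn : Module.finrank ℝ Y = n)
    (hm : 1 ≤ m) (hmn : m ≤ n) :
    ∃ C : ℝ≥0, ∀ g : X × Y → ℂ, Integrable g →
      (∀ (V : Y ≃ₗᵢ[ℝ] Y) (x y), g (x, V y) = g (x, y)) → ∀ S : ℝ, 0 < S →
      (∀ p, ‖p.2‖ < S → g p = 0) → ∀ ξ : X × Y, 1 / 2 ≤ ‖ξ.2‖ →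
      ‖waveIntegral g ξ‖ₑ
        ≤ C * ENNReal.ofReal (S ^ (-(((m : ℝ) - 1) / 2))) * ∫⁻ p, ‖g p‖ₑ := by
  have : Nontrivial Y := Module.nontrivial_of_finrank_pos (R := ℝ) (by omega)
  obtain ⟨C, hC⟩ := exists_norm_sphericalWave_le_rpow (Y := Y) hn (hm.trans hmn)
  have hm1 : (1 : ℝ) ≤ m := by exact_mod_cast hm
  have hmn1 : (m : ℝ) ≤ n := by exact_mod_cast hmn
  set a : ℝ := ((m : ℝ) - 1) / 2 with ha
  have ha0 : 0 ≤ a := by rw [ha]; linarith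
  set v : ℝ≥0 := (volume.real (Metric.ball (0 : Y) 1)).toNNReal with hv
  have hv0 : 0 < v := volume_ball_pos_toNNReal
  have h2 : (0 : ℝ) ≤ (1 / 2 : ℝ) ^ (-a) := by positivity
  -- On the support of `g` the spherical wave is evaluated at a point of norm at least `S / 2`;
  -- `v⁻¹` undoes the volume factor of the averaging identity.
  refine ⟨v⁻¹ * (C * ((1 / 2 : ℝ) ^ (-a)).toNNReal), fun g hg hsym S hS hsupp ξ hξ => ?_⟩
  have key : (v : ℝ≥0∞) * ‖waveIntegral g ξ‖ₑ
      ≤ C * ((1 / 2 : ℝ) ^ (-a)).toNNReal * ENNReal.ofReal (S ^ (-a)) * ∫⁻ p, ‖g p‖ₑ := by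
    rw [hv, ← enorm_volume_ball_mul, volume_ball_mul_waveIntegral hg hsym,
      ← lintegral_const_mul'' _ hg.1.enorm]
    refine (enorm_integral_le_lintegral_enorm _).trans (lintegral_mono fun p => ?_)
    rcases lt_or_ge ‖p.2‖ S with hp | hp
    · simp [hsupp p hp]
    rw [mul_comm _ ‖g p‖ₑ, mul_assoc (g p), enorm_mul, enorm_mul]
    have e1 : ‖Complex.exp (-Complex.I * ((inner ℝ ξ.1 p.1 : ℝ) : ℂ))‖ₑ = 1 := by
      rw [← ofReal_norm, norm_exp_neg_I_mul, ENNReal.ofReal_one]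
    rw [e1, one_mul]
    gcongr
    have hp0 : 0 < ‖p.2‖ := hS.trans_le hp
    have hξ0 : 0 < ‖ξ.2‖ := by linarith
    have hw : ‖ξ.2‖ • p.2 ≠ 0 := smul_ne_zero hξ0.ne' (norm_pos_iff.1 hp0)
    have h3 : ‖sphericalWave (‖ξ.2‖ • p.2)‖ ≤ C * (1 / 2 : ℝ) ^ (-a) * S ^ (-a) := by
      refine (hC a ha0 (by rw [ha]; linarith) _ hw).trans ?_
      rw [mul_assoc, ← Real.mul_rpow (by norm_num) hS.le, norm_smul, norm_norm]
      gcongr ?_ * ?_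
      exact Real.rpow_le_rpow_of_nonpos (by positivity)
        (mul_le_mul hξ hp hS.le hξ0.le) (by linarith)
    rw [← ofReal_norm]
    refine (ENNReal.ofReal_le_ofReal h3).trans (le_of_eq ?_)
    rw [ENNReal.ofReal_mul (by positivity), ENNReal.ofReal_mul (by positivity),
      ENNReal.ofReal_coe_nnreal]
    rfl
  rw [ENNReal.coe_mul, ENNReal.coe_inv hv0.ne', ENNReal.coe_mul]
  calc ‖waveIntegral g ξ‖ₑ = (v : ℝ≥0∞)⁻¹ * (v * ‖waveIntegral g ξ‖ₑ) := by
        rw [← mul_assoc, ENNReal.inv_mul_cancel (by exact_mod_cast hv0.ne') ENNReal.coe_ne_top,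
          one_mul]
    _ ≤ _ := by
        refine (mul_le_mul_right key _).trans (le_of_eq ?_)
        ring

/-- The square of the optimal decay is `|y|^(-(n-1))`, which cancels the polar Jacobian; the growth
in `S` is therefore linear in every dimension. -/
theorem exists_lintegral_sq_sphericalWave_le {n : ℕ} (hn : Module.finrank ℝ Y = n)
    (hn1 : 1 ≤ n) :
    ∃ C : ℝ≥0, ∀ S : ℝ, 0 < S → ∀ t : ℝ, 1 / 2 ≤ t →
      ∫⁻ y in Metric.ball (0 : Y) S, ‖sphericalWave (t • y)‖ₑ ^ 2 ≤ C * ENNReal.ofReal S := by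
  have : Nontrivial Y := Module.nontrivial_of_finrank_pos (R := ℝ) (by omega)
  obtain ⟨C, hC⟩ := exists_norm_sphericalWave_le_rpow (Y := Y) hn hn1
  have hn2 : (1 : ℝ) ≤ n := by exact_mod_cast hn1
  set a : ℝ := ((n : ℝ) - 1) / 2 with ha
  have ha0 : 0 ≤ a := by rw [ha]; linarith
  set B : ℝ := (C * (1 / 2 : ℝ) ^ (-a)) ^ 2 with hB
  have hB0 : 0 ≤ B := by positivity
  refine ⟨B.toNNReal * (n * volume.real (Metric.ball (0 : Y) 1)).toNNReal,
    fun S hS t ht => ?_⟩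
  have h1 : ∀ᵐ y ∂(volume.restrict (Metric.ball (0 : Y) S)), ‖sphericalWave (t • y)‖ₑ ^ 2
      ≤ ENNReal.ofReal B * ENNReal.ofReal (‖y‖ ^ (-((n : ℝ) - 1))) := by
    have hne : ∀ᵐ y ∂(volume.restrict (Metric.ball (0 : Y) S)), y ≠ 0 :=
      ae_restrict_of_ae (by rw [ae_iff]; simp)
    filter_upwards [hne] with y hy
    have hy0 : 0 < ‖y‖ := norm_pos_iff.2 hy
    have ht0 : 0 < t := by linarith
    rw [← ofReal_norm, ← ENNReal.ofReal_pow (norm_nonneg _), ← ENNReal.ofReal_mul hB0]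
    refine ENNReal.ofReal_le_ofReal ?_
    have h3 : ‖sphericalWave (t • y)‖ ≤ C * (1 / 2 : ℝ) ^ (-a) * ‖y‖ ^ (-a) := by
      refine (hC a ha0 le_rfl _ (smul_ne_zero ht0.ne' hy)).trans ?_
      rw [mul_assoc, ← Real.mul_rpow (by norm_num) hy0.le, norm_smul,
        Real.norm_of_nonneg ht0.le]
      gcongr ?_ * ?_
      exact Real.rpow_le_rpow_of_nonpos (by positivity)
        (mul_le_mul_of_nonneg_right ht hy0.le) (by linarith)
    refine (pow_le_pow_left₀ (norm_nonneg _) h3 2).trans (le_of_eq ?_)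
    rw [mul_pow, hB, ← Real.rpow_natCast (‖y‖ ^ (-a)), ← Real.rpow_mul hy0.le, ha]
    congr 2
    push_cast
    ring
  refine (lintegral_mono_ae h1).trans (le_of_eq ?_)
  rw [lintegral_const_mul' _ _ ENNReal.ofReal_ne_top, lintegral_ball_norm_rpow hn hn1 hS,
    ENNReal.ofReal_mul (by positivity), ← mul_assoc, ENNReal.coe_mul]
  rfl

/-- `L²` bound for the Fourier integral of a function that is rotation invariant in the second
variable and lives where that variable is at most `S`. -/
theorem exists_lintegral_sq_waveIntegral_le {n : ℕ} (hn : Module.finrank ℝ Y = n)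
    (hn1 : 1 ≤ n) :
    ∃ C : ℝ≥0, ∀ (A : ℝ≥0) (ν : Measure (X × Y)), (∀ᵐ ξ ∂ν, 1 / 2 ≤ ‖ξ.2‖) →
      ν.map Prod.fst ≤ A • volume → ∀ g : X × Y → ℂ, Integrable g → ∫⁻ p, ‖g p‖ₑ ^ 2 < ∞ →
      (∀ (V : Y ≃ₗᵢ[ℝ] Y) (x y), g (x, V y) = g (x, y)) → ∀ S : ℝ, 0 < S →
      (∀ p, S ≤ ‖p.2‖ → g p = 0) →
      ∫⁻ ξ, ‖waveIntegral g ξ‖ₑ ^ 2 ∂ν ≤ C * A * ENNReal.ofReal S * ∫⁻ p, ‖g p‖ₑ ^ 2 := by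
  have : Nontrivial Y := Module.nontrivial_of_finrank_pos (R := ℝ) (by omega)
  obtain ⟨C₁, hC₁⟩ := exists_lintegral_sq_sphericalWave_le (Y := Y) hn hn1
  obtain ⟨C₂, hC₂⟩ := exists_lintegral_enorm_sq_fourierIntegral_le X
  set v : ℝ≥0 := (volume.real (Metric.ball (0 : Y) 1)).toNNReal with hv
  have hv0 : 0 < v := volume_ball_pos_toNNReal
  refine ⟨(v ^ 2)⁻¹ * (C₁ * C₂), fun A ν hν hA g hg hg2 hsym S hS hsupp => ?_⟩
  -- a measurable representative with the same support property
  set T : Set (X × Y) := {p | ‖p.2‖ < S} with hT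
  have hTm : MeasurableSet T := measurableSet_lt (by fun_prop) measurable_const
  set f : X × Y → ℂ := T.indicator (hg.1.mk g) with hf
  have hfm : StronglyMeasurable f := hg.1.stronglyMeasurable_mk.indicator hTm
  have hgf : g =ᵐ[volume] f := by
    filter_upwards [hg.1.ae_eq_mk] with p hp
    by_cases hpT : p ∈ T
    · rw [hf, Set.indicator_of_mem hpT, hp]
    · rw [hf, Set.indicator_of_notMem hpT, hsupp p (not_lt.1 hpT)]
  have hfi : Integrable f := hg.congr hgf
  have hf2 : ∫⁻ p, ‖f p‖ₑ ^ 2 = ∫⁻ p, ‖g p‖ₑ ^ 2 := by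
    refine lintegral_congr_ae ?_
    filter_upwards [hgf] with p hp
    rw [hp]
  -- The partial Fourier transform in `x`. The full transform is its pairing in `y` with the
  -- spherical wave, up to the volume factor.
  set G : X → Y → ℂ := fun η y =>
    ∫ x, f (x, y) * Complex.exp (-Complex.I * ((inner ℝ η x : ℝ) : ℂ)) with hG
  have hGm : StronglyMeasurable (Function.uncurry G) := by
    refine StronglyMeasurable.integral_prod_right (f := fun (z : X × Y) (x : X) => f (x, z.2) *
      Complex.exp (-Complex.I * ((inner ℝ z.1 x : ℝ) : ℂ))) ?_
    refine StronglyMeasurable.mul (hfm.comp_measurable (by fun_prop)) ?_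
    exact Measurable.stronglyMeasurable (by fun_prop)
  have hGm1 : ∀ η, StronglyMeasurable (G η) := fun η => hGm.of_uncurry_left
  have hGsupp : ∀ η y, y ∉ Metric.ball (0 : Y) S → G η y = 0 := by
    intro η y hy
    have : ∀ x, f (x, y) = 0 := fun x => Set.indicator_of_notMem (by simpa [hT] using hy) _
    simp [hG, this]
  set H : X → ℝ≥0∞ := fun η => ∫⁻ y, ‖G η y‖ₑ ^ 2 with hH
  have hHm : Measurable H :=
    Measurable.lintegral_prod_right' (f := fun z : X × Y => ‖G z.1 z.2‖ₑ ^ 2)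
      (hGm.enorm.pow_const 2)
  -- After Cauchy-Schwarz in `y` the bound depends on `ξ.1` alone, so only the first marginal of `ν`
  -- enters.
  have hpt : ∀ᵐ ξ ∂ν, (v : ℝ≥0∞) ^ 2 * ‖waveIntegral g ξ‖ₑ ^ 2
      ≤ C₁ * ENNReal.ofReal S * H ξ.1 := by
    filter_upwards [hν] with ξ hξ
    have e1 : (volume.real (Metric.ball (0 : Y) 1) : ℂ) * waveIntegral g ξ
        = ∫ y, G ξ.1 y * sphericalWave (‖ξ.2‖ • y) := by
      rw [volume_ball_mul_waveIntegral hg hsym]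
      have e2 : ∫ p : X × Y, g p * Complex.exp (-Complex.I * ((inner ℝ ξ.1 p.1 : ℝ) : ℂ))
          * sphericalWave (‖ξ.2‖ • p.2)
          = ∫ p : X × Y, f p * Complex.exp (-Complex.I * ((inner ℝ ξ.1 p.1 : ℝ) : ℂ))
          * sphericalWave (‖ξ.2‖ • p.2) := by
        refine integral_congr_ae ?_
        filter_upwards [hgf] with p hp
        rw [hp]
      rw [e2, Measure.volume_eq_prod, integral_prod_symm]
      · simp only [integral_mul_const, hG]
      · rw [← Measure.volume_eq_prod]
        refine (hfi.mul_bdd (c := 1) (g := fun p : X × Y =>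
          Complex.exp (-Complex.I * ((inner ℝ ξ.1 p.1 : ℝ) : ℂ))) ?_ ?_).mul_bdd
          (c := volume.real (Metric.ball (0 : Y) 1)) ?_ ?_
        · exact Measurable.aestronglyMeasurable (by fun_prop)
        · exact .of_forall fun z => (norm_exp_neg_I_mul _).le
        · exact (stronglyMeasurable_sphericalWave.comp_measurable
            (by fun_prop)).aestronglyMeasurable
        · exact .of_forall fun z => norm_sphericalWave_le _
    rw [← mul_pow, hv, ← enorm_volume_ball_mul, e1]
    have e3 : ‖∫ y, G ξ.1 y * sphericalWave (‖ξ.2‖ • y)‖ₑ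
        ≤ ∫⁻ y in Metric.ball (0 : Y) S, ‖sphericalWave (‖ξ.2‖ • y)‖ₑ * ‖G ξ.1 y‖ₑ := by
      refine (enorm_integral_le_lintegral_enorm _).trans ?_
      rw [← lintegral_indicator Metric.isOpen_ball.measurableSet]
      refine lintegral_mono fun y => ?_
      by_cases hy : y ∈ Metric.ball (0 : Y) S
      · rw [Set.indicator_of_mem hy, enorm_mul, mul_comm]
      · simp [hGsupp ξ.1 y hy]
    refine (pow_le_pow_left₀ zero_le e3 2).trans ?_
    refine (lintegral_mul_sq_le _
      (stronglyMeasurable_sphericalWave.comp_measurable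
        (measurable_const_smul ‖ξ.2‖)).enorm.aemeasurable (hGm1 ξ.1).enorm.aemeasurable).trans ?_
    exact mul_le_mul' (hC₁ S hS ‖ξ.2‖ hξ) (setLIntegral_le_lintegral _ _)
  -- Plancherel in `x` on almost every slice of fixed `y`.
  have hplanch : ∫⁻ η, H η ≤ C₂ * ∫⁻ p, ‖g p‖ₑ ^ 2 := by
    have hfm2 : Measurable fun p : X × Y => ‖f p‖ₑ ^ 2 := hfm.enorm.pow_const 2
    have e1 : ∫⁻ p, ‖f p‖ₑ ^ 2 = ∫⁻ y, ∫⁻ x, ‖f (x, y)‖ₑ ^ 2 := by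
      rw [Measure.volume_eq_prod, lintegral_prod_symm _ hfm2.aemeasurable]
    rw [hH, lintegral_lintegral_swap (hGm.enorm.pow_const 2).aemeasurable, ← hf2, e1,
      ← lintegral_const_mul _ hfm2.lintegral_prod_left']
    refine lintegral_mono_ae ?_
    have a1 : ∀ᵐ y, Integrable fun x => f (x, y) := by
      have := hfi
      rw [Measure.volume_eq_prod] at this
      exact this.prod_left_ae
    have a2 : ∀ᵐ y, ∫⁻ x, ‖f (x, y)‖ₑ ^ 2 < ∞ :=
      ae_lt_top hfm2.lintegral_prod_left' (by rw [← e1, hf2]; exact hg2.ne)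
    filter_upwards [a1, a2] with y h1 h2
    refine hC₂ _ h1 ⟨h1.1, ?_⟩
    rw [eLpNorm_lt_top_iff_lintegral_rpow_enorm_lt_top (by norm_num) (by norm_num)]
    simpa using h2
  have hfinal : (v : ℝ≥0∞) ^ 2 * ∫⁻ ξ, ‖waveIntegral g ξ‖ₑ ^ 2 ∂ν
      ≤ C₁ * ENNReal.ofReal S * (A * (C₂ * ∫⁻ p, ‖g p‖ₑ ^ 2)) := by
    rw [← lintegral_const_mul' _ _ (by finiteness)]
    refine (lintegral_mono_ae hpt).trans ?_
    rw [lintegral_const_mul' _ _ (by finiteness), ← lintegral_map hHm measurable_fst]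
    gcongr
    refine (lintegral_mono' hA le_rfl).trans ?_
    rw [lintegral_smul_measure]
    exact mul_le_mul_right hplanch _
  calc ∫⁻ ξ, ‖waveIntegral g ξ‖ₑ ^ 2 ∂ν
      = ((v : ℝ≥0∞) ^ 2)⁻¹ * ((v : ℝ≥0∞) ^ 2 * ∫⁻ ξ, ‖waveIntegral g ξ‖ₑ ^ 2 ∂ν) := by
        rw [← mul_assoc, ENNReal.inv_mul_cancel _ (by finiteness), one_mul]
        exact pow_ne_zero 2 (by exact_mod_cast hv0.ne')
    _ ≤ _ := by
        refine (mul_le_mul_right hfinal _).trans (le_of_eq ?_)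
        rw [ENNReal.coe_mul, ENNReal.coe_inv (pow_ne_zero 2 hv0.ne'), ENNReal.coe_mul,
          ENNReal.coe_pow]
        ring

end WaveIntegralEstimates

/-! ### Optimising the cut, and passing from bounded functions to all integrable ones. -/

section RestrictedEstimate

variable {X Y : Type*} [NormedAddCommGroup X] [InnerProductSpace ℝ X] [FiniteDimensional ℝ X]
  [MeasurableSpace X] [BorelSpace X]
  [NormedAddCommGroup Y] [InnerProductSpace ℝ Y] [FiniteDimensional ℝ Y]
  [MeasurableSpace Y] [BorelSpace Y]

/-- Restricted form of the estimate: functions bounded by one. -/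
theorem exists_lintegral_waveIntegral_le_of_norm_le_one {n m : ℕ}
    (hn : Module.finrank ℝ Y = n) (hm : 1 ≤ m) (hmn : m ≤ n) (A : ℝ≥0) :
    ∃ C : ℝ≥0, ∀ (ν : Measure (X × Y)) [IsFiniteMeasure ν], (∀ᵐ ξ ∂ν, 1 / 2 ≤ ‖ξ.2‖) →
      ν.map Prod.fst ≤ A • volume → ∀ g : X × Y → ℂ, Integrable g → (∀ p, ‖g p‖ ≤ 1) →
      (∀ (V : Y ≃ₗᵢ[ℝ] Y) (x y), g (x, V y) = g (x, y)) →
      ∫⁻ ξ, ‖waveIntegral g ξ‖ₑ ∂ν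
        ≤ C * (ν Set.univ * ∫⁻ p, ‖g p‖ₑ) ^ (((m : ℝ) + 1) / (2 * m)) := by
  obtain ⟨C₁, hC₁⟩ := exists_enorm_waveIntegral_le_of_tail (X := X) (Y := Y) hn hm hmn
  obtain ⟨C₂, hC₂⟩ := exists_lintegral_sq_waveIntegral_le (X := X) (Y := Y) hn (hm.trans hmn)
  have hm0 : (0 : ℝ) < m := by exact_mod_cast hm
  set r : ℝ := ((m : ℝ) + 1) / (2 * m) with hr
  have hr0 : 0 < r := by positivity
  refine ⟨(C₂ * A) ^ (1 / 2 : ℝ) + C₁, fun ν _ hν hA g hg hg1 hsym => ?_⟩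
  set a := ν Set.univ with ha
  set e := ∫⁻ p, ‖g p‖ₑ with he
  have hea : e < ∞ := hg.2
  have haa : a < ∞ := measure_lt_top ν _
  rcases eq_or_ne a 0 with h0 | ha0
  · rw [Measure.measure_univ_eq_zero.1 h0, lintegral_zero_measure]
    exact zero_le
  rcases eq_or_ne e 0 with h0 | he0
  · have hz : g =ᵐ[volume] fun _ => 0 := by
      have := (lintegral_eq_zero_iff' hg.1.enorm).1 h0
      filter_upwards [this] with p hp
      simpa using hp
    rw [waveIntegral_congr_ae hz]
    simp [waveIntegral]
  set P := a * e with hP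
  have hP0 : P ≠ 0 := mul_ne_zero ha0 he0
  have hPt : P ≠ ∞ := ENNReal.mul_ne_top haa.ne hea.ne
  have hPr : 0 < P.toReal := ENNReal.toReal_pos hP0 hPt
  -- This radius balances the near bound `(P S)^(1/2)` against the far bound `P S^(-(m-1)/2)`; both
  -- become `P ^ r`.
  set S : ℝ := P.toReal ^ (1 / (m : ℝ)) with hS
  have hS0 : 0 < S := Real.rpow_pos_of_pos hPr _
  have hSP : ∀ b : ℝ, ENNReal.ofReal (S ^ b) = P ^ (b / m) := by
    intro b
    rw [hS, ← Real.rpow_mul hPr.le, ← ENNReal.ofReal_rpow_of_pos hPr, ENNReal.ofReal_toReal hPt]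
    congr 1
    ring
  have hPadd : ∀ s : ℝ, P ^ s * P = P ^ (s + 1) := fun s => by
    rw [ENNReal.rpow_add _ _ hP0 hPt, ENNReal.rpow_one]
  set T : Set (X × Y) := {p | ‖p.2‖ < S} with hT
  have hTm : MeasurableSet T := measurableSet_lt (by fun_prop) measurable_const
  have hTV : ∀ (V : Y ≃ₗᵢ[ℝ] Y) x y, (x, V y) ∈ T ↔ (x, y) ∈ T := fun V x y => by simp [hT]
  have hsym1 : ∀ (V : Y ≃ₗᵢ[ℝ] Y) x y, T.indicator g (x, V y) = T.indicator g (x, y) := by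
    intro V x y
    by_cases h : (x, y) ∈ T
    · rw [Set.indicator_of_mem h, Set.indicator_of_mem ((hTV V x y).2 h), hsym]
    · rw [Set.indicator_of_notMem h, Set.indicator_of_notMem (mt (hTV V x y).1 h)]
  have hsym2 : ∀ (V : Y ≃ₗᵢ[ℝ] Y) x y, Tᶜ.indicator g (x, V y) = Tᶜ.indicator g (x, y) := by
    intro V x y
    by_cases h : (x, y) ∈ T
    · rw [Set.indicator_of_notMem (Set.notMem_compl_iff.2 ((hTV V x y).2 h)),
        Set.indicator_of_notMem (Set.notMem_compl_iff.2 h)]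
    · rw [Set.indicator_of_mem (s := Tᶜ) (mt (hTV V x y).1 h),
        Set.indicator_of_mem (s := Tᶜ) h, hsym]
  have hg_1 : Integrable (T.indicator g) := hg.indicator hTm
  have hg_2 : Integrable (Tᶜ.indicator g) := hg.indicator hTm.compl
  have hsplit : ∀ ξ, waveIntegral g ξ
      = waveIntegral (T.indicator g) ξ + waveIntegral (Tᶜ.indicator g) ξ := by
    intro ξ
    rw [← waveIntegral_add hg_1 hg_2, Set.indicator_self_add_compl]
  -- Here `|g| ≤ 1` enters, through `|g|² ≤ |g|`.
  have hle2 : ∫⁻ p, ‖T.indicator g p‖ₑ ^ 2 ≤ e := by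
    refine lintegral_mono fun p => ?_
    by_cases h : p ∈ T
    · rw [Set.indicator_of_mem h, sq]
      have : ‖g p‖ₑ ≤ 1 := by
        rw [← ofReal_norm, ← ENNReal.ofReal_one]
        exact ENNReal.ofReal_le_ofReal (hg1 p)
      exact mul_le_of_le_one_left zero_le this
    · simp [Set.indicator_of_notMem h]
  have hle1 : ∫⁻ p, ‖Tᶜ.indicator g p‖ₑ ≤ e :=
    lintegral_mono fun p => enorm_indicator_le_enorm_self _ _
  -- the part with small second variable
  have hL2 := hC₂ A ν hν hA (T.indicator g) hg_1 (hle2.trans_lt hea) hsym1 S hS0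
    (fun p hp => Set.indicator_of_notMem (by simpa [hT] using hp) _)
  have hpart1 : ∫⁻ ξ, ‖waveIntegral (T.indicator g) ξ‖ₑ ∂ν
      ≤ ((C₂ * A) ^ (1 / 2 : ℝ) : ℝ≥0) * P ^ r := by
    have hsq : (∫⁻ ξ, ‖waveIntegral (T.indicator g) ξ‖ₑ ∂ν) ^ 2
        ≤ (C₂ * A : ℝ≥0) * P ^ (2 * r) := by
      have h := lintegral_mul_sq_le ν (f := fun _ => 1)
        (g := fun ξ => ‖waveIntegral (T.indicator g) ξ‖ₑ) aemeasurable_const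
        (stronglyMeasurable_waveIntegral hg_1.1).enorm.aemeasurable
      simp only [one_mul, one_pow, lintegral_const] at h
      refine h.trans ?_
      have e1 : P ^ (2 * r) = P ^ (1 / (m : ℝ)) * P := by
        rw [hPadd]
        congr 1
        rw [hr]
        field_simp
        ring
      have e2 : ENNReal.ofReal S = P ^ (1 / (m : ℝ)) := by
        have := hSP 1
        rwa [Real.rpow_one] at this
      calc a * ∫⁻ ξ, ‖waveIntegral (T.indicator g) ξ‖ₑ ^ 2 ∂ν
          ≤ a * (C₂ * A * ENNReal.ofReal S * e) := by
            gcongr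
            exact hL2.trans (mul_le_mul_right hle2 _)
        _ = (C₂ * A : ℝ≥0) * P ^ (2 * r) := by
            rw [e1, e2, hP, ENNReal.coe_mul]; ring
    have h3 := ENNReal.rpow_le_rpow hsq (by norm_num : (0 : ℝ) ≤ 1 / 2)
    rw [← ENNReal.rpow_two, ← ENNReal.rpow_mul, ENNReal.mul_rpow_of_nonneg _ _ (by norm_num),
      ← ENNReal.rpow_mul, ← ENNReal.coe_rpow_of_nonneg _ (by norm_num)] at h3
    convert h3 using 2
    · norm_num
    · congr 1; ring
  have hpart2 : ∫⁻ ξ, ‖waveIntegral (Tᶜ.indicator g) ξ‖ₑ ∂ν ≤ C₁ * P ^ r := by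
    have h : ∀ᵐ ξ ∂ν, ‖waveIntegral (Tᶜ.indicator g) ξ‖ₑ
        ≤ C₁ * P ^ (-(((m : ℝ) - 1) / 2) / m) * e := by
      filter_upwards [hν] with ξ hξ
      refine (hC₁ _ hg_2 hsym2 S hS0
        (fun p hp => Set.indicator_of_notMem (by simpa [hT] using hp) _) ξ hξ).trans ?_
      rw [hSP]
      exact mul_le_mul_right hle1 _
    refine (lintegral_mono_ae h).trans (le_of_eq ?_)
    rw [lintegral_const]
    have e1 : P ^ r = P ^ (-(((m : ℝ) - 1) / 2) / m) * P := by
      rw [hPadd]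
      congr 1
      rw [hr]
      field_simp
      ring
    rw [e1, ← ha]
    conv_rhs => rw [hP]
    ring
  calc ∫⁻ ξ, ‖waveIntegral g ξ‖ₑ ∂ν
      ≤ ∫⁻ ξ, ‖waveIntegral (T.indicator g) ξ‖ₑ + ‖waveIntegral (Tᶜ.indicator g) ξ‖ₑ ∂ν := by
        refine lintegral_mono fun ξ => ?_
        rw [hsplit]
        exact enorm_add_le _ _
    _ = _ := lintegral_add_left (stronglyMeasurable_waveIntegral hg_1.1).enorm _
    _ ≤ _ := add_le_add hpart1 hpart2
    _ = _ := by rw [ENNReal.coe_add, add_mul]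

/-- The unimodular truncation `1_{|z| > t} z / |z|`. -/
noncomputable def unimodularAbove (t : ℝ) (z : ℂ) : ℂ :=
  if t < ‖z‖ then ((‖z‖⁻¹ : ℝ) : ℂ) * z else 0

theorem norm_unimodularAbove {t : ℝ} (ht : 0 < t) (z : ℂ) :
    ‖unimodularAbove t z‖ = if t < ‖z‖ then 1 else 0 := by
  unfold unimodularAbove
  split_ifs with h
  · rw [norm_mul, Complex.norm_real, norm_inv, norm_norm, inv_mul_cancel₀ (ht.trans h).ne']
  · simp

theorem enorm_unimodularAbove {t : ℝ} (ht : 0 < t) (z : ℂ) :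
    ‖unimodularAbove t z‖ₑ = if t < ‖z‖ then 1 else 0 := by
  rw [← ofReal_norm, norm_unimodularAbove ht]
  split_ifs <;> simp

theorem measurable_unimodularAbove :
    Measurable fun q : ℝ × ℂ => unimodularAbove q.1 q.2 := by
  unfold unimodularAbove
  refine Measurable.ite (measurableSet_lt (by fun_prop) (by fun_prop)) (by fun_prop) (by fun_prop)

/-- The layer cake formula with the phase kept: it writes a function as a superposition of functions
of modulus `0` or `1` that share its symmetries. -/
theorem integral_unimodularAbove (z : ℂ) : ∫ t in Set.Ioi (0 : ℝ), unimodularAbove t z = z := by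
  have h : ∀ t, unimodularAbove t z
      = (Set.Iio ‖z‖).indicator (fun _ => ((‖z‖⁻¹ : ℝ) : ℂ) * z) t := by
    intro t
    simp only [unimodularAbove, Set.indicator, Set.mem_Iio]
  simp_rw [h]
  rw [setIntegral_indicator measurableSet_Iio, setIntegral_const, Set.Ioi_inter_Iio]
  simp only [Real.volume_real_Ioo, sub_zero, norm_nonneg, max_eq_left, Complex.real_smul]
  rcases eq_or_ne z 0 with rfl | hz
  · simp
  · rw [← mul_assoc, ← Complex.ofReal_mul, mul_inv_cancel₀ (norm_ne_zero_iff.2 hz),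
      Complex.ofReal_one, one_mul]

theorem lintegral_enorm_unimodularAbove (z : ℂ) :
    ∫⁻ t in Set.Ioi (0 : ℝ), ‖unimodularAbove t z‖ₑ = ‖z‖ₑ := by
  rw [setLIntegral_congr_fun (g := (Set.Iio ‖z‖).indicator fun _ => (1 : ℝ≥0∞))
    measurableSet_Ioi (fun t ht => by
      simp only [enorm_unimodularAbove ht, Set.indicator, Set.mem_Iio])]
  rw [setLIntegral_indicator measurableSet_Iio, Set.inter_comm, Set.Ioi_inter_Iio]
  simp [← ofReal_norm]

/-- The estimate for Fourier integrals of functions that are rotation invariant in the second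
variable, against a measure that lives where the second frequency is not small. -/
theorem exists_lintegral_waveIntegral_le {n m : ℕ}
    (hn : Module.finrank ℝ Y = n) (hm : 1 ≤ m) (hmn : m ≤ n) (A : ℝ≥0) :
    ∃ C : ℝ≥0, ∀ (ν : Measure (X × Y)) [IsFiniteMeasure ν], (∀ᵐ ξ ∂ν, 1 / 2 ≤ ‖ξ.2‖) →
      ν.map Prod.fst ≤ A • volume → ∀ g : X × Y → ℂ, Integrable g →
      (∀ (V : Y ≃ₗᵢ[ℝ] Y) (x y), g (x, V y) = g (x, y)) →
      ∫⁻ ξ, ‖waveIntegral g ξ‖ₑ ∂ν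
        ≤ C * ν Set.univ ^ (((m : ℝ) + 1) / (2 * m)) *
          ∫⁻ t in Set.Ioi (0 : ℝ), volume {p | t < ‖g p‖} ^ (((m : ℝ) + 1) / (2 * m)) := by
  obtain ⟨C, hC⟩ := exists_lintegral_waveIntegral_le_of_norm_le_one (X := X) (Y := Y) hn hm hmn A
  have hm0 : (0 : ℝ) < m := by exact_mod_cast hm
  set r : ℝ := ((m : ℝ) + 1) / (2 * m) with hr
  have hr0 : 0 < r := by positivity
  refine ⟨C, fun ν _ hν hA g hg hsym => ?_⟩
  -- The measurable representative, which need not be symmetric, serves joint measurability in `(t,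
  -- p)`; the restricted estimate is applied to the layers of `g` itself.
  set f := hg.1.mk g with hf
  have hfm : StronglyMeasurable f := hg.1.stronglyMeasurable_mk
  have hgf : g =ᵐ[volume] f := hg.1.ae_eq_mk
  have hUm : Measurable fun q : ℝ × (X × Y) => unimodularAbove q.1 (f q.2) :=
    measurable_unimodularAbove.comp
      (measurable_fst.prodMk (hfm.measurable.comp measurable_snd))
  have hUi : Integrable (fun q : ℝ × (X × Y) => unimodularAbove q.1 (f q.2))
      ((volume.restrict (Set.Ioi 0)).prod volume) := by
    refine ⟨hUm.aestronglyMeasurable, ?_⟩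
    rw [HasFiniteIntegral, lintegral_prod_symm _ hUm.enorm.aemeasurable]
    simp only [lintegral_enorm_unimodularAbove]
    exact (hg.congr hgf).2
  have hrepr : ∀ ξ, waveIntegral g ξ
      = ∫ t in Set.Ioi (0 : ℝ), waveIntegral (fun p => unimodularAbove t (f p)) ξ := by
    intro ξ
    rw [waveIntegral_congr_ae hgf]
    simp only [waveIntegral]
    rw [integral_integral_swap]
    · simp only [integral_mul_const, integral_unimodularAbove]
    · exact hUi.mul_bdd (c := 1) (Measurable.aestronglyMeasurable (by fun_prop))
        (.of_forall fun z => (norm_exp_neg_I_mul _).le)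
  have hWm : StronglyMeasurable fun q : (X × Y) × ℝ =>
      waveIntegral (fun p => unimodularAbove q.2 (f p)) q.1 := by
    refine StronglyMeasurable.integral_prod_right (f := fun (q : (X × Y) × ℝ) (p : X × Y) =>
      unimodularAbove q.2 (f p) *
      Complex.exp (-Complex.I * ((inner ℝ q.1.1 p.1 + inner ℝ q.1.2 p.2 : ℝ) : ℂ))) ?_
    refine Measurable.stronglyMeasurable (Measurable.mul ?_ (by fun_prop))
    exact hUm.comp (by fun_prop : Measurable fun z : ((X × Y) × ℝ) × (X × Y) => (z.1.2, z.2))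
  calc ∫⁻ ξ, ‖waveIntegral g ξ‖ₑ ∂ν
      ≤ ∫⁻ ξ, (∫⁻ t in Set.Ioi (0 : ℝ),
          ‖waveIntegral (fun p => unimodularAbove t (f p)) ξ‖ₑ) ∂ν := by
        refine lintegral_mono fun ξ => ?_
        rw [hrepr]
        exact enorm_integral_le_lintegral_enorm _
    _ = ∫⁻ t in Set.Ioi (0 : ℝ), (∫⁻ ξ,
          ‖waveIntegral (fun p => unimodularAbove t (f p)) ξ‖ₑ ∂ν) :=
        lintegral_lintegral_swap hWm.enorm.aemeasurable
    _ ≤ ∫⁻ t in Set.Ioi (0 : ℝ), C * ν Set.univ ^ r * volume {p | t < ‖g p‖} ^ r := by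
        refine setLIntegral_mono' measurableSet_Ioi fun t ht => ?_
        have ht0 : (0 : ℝ) < t := ht
        have hcongr : (fun p => unimodularAbove t (f p)) =ᵐ[volume]
            fun p => unimodularAbove t (g p) := by
          filter_upwards [hgf] with p hp
          rw [hp]
        rw [waveIntegral_congr_ae hcongr]
        have hnm : NullMeasurableSet {p | t < ‖g p‖} volume :=
          nullMeasurableSet_lt aemeasurable_const hg.1.norm.aemeasurable
        -- The `L¹` norm of a layer is the value of the distribution function, which turns the
        -- integral over `t` into the Lorentz functional.
        have hint : ∫⁻ p, ‖unimodularAbove t (g p)‖ₑ = volume {p | t < ‖g p‖} := by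
          rw [← lintegral_indicator_one₀ hnm]
          refine lintegral_congr fun p => ?_
          simp only [enorm_unimodularAbove ht0, Set.indicator, Set.mem_ofPred_eq, Pi.one_apply]
        have hfin : volume {p | t < ‖g p‖} < ∞ := by
          refine (measure_mono fun p hp => ?_).trans_lt (hg.measure_norm_ge_lt_top ht0)
          exact (le_of_lt hp : t ≤ ‖g p‖)
        have hgi : Integrable fun p => unimodularAbove t (g p) := by
          refine ⟨?_, by rw [HasFiniteIntegral, hint]; exact hfin⟩
          refine AEStronglyMeasurable.congr ?_ hcongr
          exact (hUm.comp (measurable_const.prodMk measurable_id)).aestronglyMeasurable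
        have := hC ν hν hA (fun p => unimodularAbove t (g p)) hgi (fun p => by
          rw [norm_unimodularAbove ht0]; split_ifs <;> norm_num) (fun V x y => by rw [hsym])
        rwa [hint, ENNReal.mul_rpow_of_nonneg _ _ hr0.le, ← mul_assoc] at this
    _ = _ := lintegral_const_mul' _ _
        (ENNReal.mul_ne_top ENNReal.coe_ne_top (ENNReal.rpow_ne_top_of_nonneg hr0.le
          (measure_ne_top _ _)))

end RestrictedEstimate

/-! ### Projecting the sphere to one block with bounded density. -/

section SphereChart

open scoped Pointwise

/-- Volume is a multiple of the Hausdorff measure of the same dimension, for which the bound is the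
standard one. -/
theorem LipschitzOnWith.volume_image_le {X : Type*} [NormedAddCommGroup X]
    [InnerProductSpace ℝ X] [FiniteDimensional ℝ X] [MeasurableSpace X] [BorelSpace X]
    {f : X → X} {K : ℝ≥0} {s : Set X} (hf : LipschitzOnWith K f s) :
    volume (f '' s) ≤ (K : ℝ≥0∞) ^ Module.finrank ℝ X * volume s := by
  have h := Measure.isAddLeftInvariant_eq_smul (volume : Measure X)
    (Measure.hausdorffMeasure (Module.finrank ℝ X : ℝ))
  set c := Measure.addHaarScalarFactor (volume : Measure X)
    (Measure.hausdorffMeasure (Module.finrank ℝ X : ℝ))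
  rw [h, Measure.smul_apply, Measure.smul_apply, mul_smul_comm]
  refine smul_le_smul_of_nonneg_left ?_ zero_le
  have := hf.hausdorffMeasure_image_le (d := (Module.finrank ℝ X : ℝ)) (by positivity)
  rwa [ENNReal.rpow_natCast] at this

/-- The central projection from the tangent hyperplane onto the sphere does not compress volumes
on the unit ball. -/
theorem exists_volume_preimage_central_projection_le (X : Type*) [NormedAddCommGroup X]
    [InnerProductSpace ℝ X] [FiniteDimensional ℝ X] [MeasurableSpace X] [BorelSpace X] :
    ∃ K : ℝ≥0, ∀ B : Set X,
      volume {u : X | ‖u‖ ≤ 1 ∧ (√(1 + ‖u‖ ^ 2))⁻¹ • u ∈ B} ≤ K * volume B := by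
  -- The inverse of `u ↦ u / √(1 + ‖u‖²)`. The image of the unit ball lies in the ball of radius
  -- `1/√2`, away from the singularity of `ψ` at `‖v‖ = 1`, so `ψ` is Lipschitz there.
  set ψ : X → X := fun v => (√(1 - ‖v‖ ^ 2))⁻¹ • v with hψ
  set D : Set X := Metric.closedBall 0 (√2)⁻¹ with hD
  have hs2 : (√2)⁻¹ ^ 2 = (1 / 2 : ℝ) := by
    rw [inv_pow, Real.sq_sqrt (by norm_num)]; norm_num
  have hlip : LocallyLipschitzOn D ψ := by
    intro v hv
    have hv1 : ‖v‖ ^ 2 ≤ 1 / 2 := by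
      rw [← hs2]
      exact pow_le_pow_left₀ (norm_nonneg _) (by simpa [hD] using hv) 2
    have hpos : 0 < 1 - ‖v‖ ^ 2 := by linarith
    have hc : ContDiffAt ℝ 1 ψ v := by
      have h1 : ContDiffAt ℝ 1 (fun v : X => 1 - ‖v‖ ^ 2) v :=
        contDiffAt_const.sub (contDiff_norm_sq ℝ).contDiffAt
      exact ((h1.sqrt hpos.ne').inv (Real.sqrt_pos.2 hpos).ne').smul contDiffAt_id
    obtain ⟨K, t, ht, hK⟩ := hc.exists_lipschitzOnWith
    exact ⟨K, t, mem_nhdsWithin_of_mem_nhds ht, hK⟩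
  obtain ⟨K, hK⟩ := hlip.exists_lipschitzOnWith_of_compact (isCompact_closedBall _ _)
  refine ⟨K ^ Module.finrank ℝ X, fun B => ?_⟩
  have hsub : {u : X | ‖u‖ ≤ 1 ∧ (√(1 + ‖u‖ ^ 2))⁻¹ • u ∈ B} ⊆ ψ '' (D ∩ B) := by
    rintro u ⟨hu1, hu2⟩
    have hpos : 0 < 1 + ‖u‖ ^ 2 := by positivity
    have hn : ‖(√(1 + ‖u‖ ^ 2))⁻¹ • u‖ ^ 2 = ‖u‖ ^ 2 / (1 + ‖u‖ ^ 2) := by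
      rw [norm_smul, mul_pow, Real.norm_of_nonneg (by positivity), inv_pow,
        Real.sq_sqrt hpos.le]
      field_simp
    refine ⟨_, ⟨?_, hu2⟩, ?_⟩
    · rw [hD, mem_closedBall_zero_iff]
      refine le_of_sq_le_sq ?_ (by positivity)
      rw [hn, hs2, div_le_div_iff₀ hpos (by norm_num)]
      nlinarith [norm_nonneg u, hu1]
    · simp only [hψ, hn]
      have e1 : 1 - ‖u‖ ^ 2 / (1 + ‖u‖ ^ 2) = (1 + ‖u‖ ^ 2)⁻¹ := by field_simp; ring
      rw [e1, Real.sqrt_inv, inv_inv, smul_smul, mul_inv_cancel₀ (Real.sqrt_pos.2 hpos).ne',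
        one_smul]
  refine (measure_mono hsub).trans
    (((hK.mono Set.inter_subset_left).volume_image_le).trans ?_)
  rw [ENNReal.coe_pow]
  exact mul_le_mul_right (measure_mono Set.inter_subset_right) _

variable {X Y E : Type*} [NormedAddCommGroup X] [InnerProductSpace ℝ X] [FiniteDimensional ℝ X]
  [MeasurableSpace X] [BorelSpace X]
  [NormedAddCommGroup Y] [InnerProductSpace ℝ Y] [FiniteDimensional ℝ Y]
  [MeasurableSpace Y] [BorelSpace Y]
  [NormedAddCommGroup E] [InnerProductSpace ℝ E] [FiniteDimensional ℝ E]
  [MeasurableSpace E] [BorelSpace E]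

/-- In an orthogonal sum, the part of the unit sphere where the second component dominates is
parametrised by the first component, with bounded density. -/
theorem exists_toSphere_le_of_fst_le_snd (e : E ≃L[ℝ] X × Y) (he : MeasurePreserving e)
    (hin : ∀ x y, inner ℝ x y = inner ℝ (e x).1 (e y).1 + inner ℝ (e x).2 (e y).2) :
    ∃ A : ℝ≥0, ∀ B : Set X, MeasurableSet B →
      (volume : Measure E).toSphere
        {ω | ‖(e ω).1‖ ≤ ‖(e ω).2‖ ∧ (e ω).1 ∈ B} ≤ A * volume B := by
  obtain ⟨K, hK⟩ := exists_volume_preimage_central_projection_le X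
  have hbt : volume (Metric.ball (0 : Y) 1) ≠ ∞ := measure_ball_lt_top.ne
  refine ⟨Module.finrank ℝ E * ((volume (Metric.ball (0 : Y) 1)).toNNReal * K), fun B hB => ?_⟩
  set D : Set X := {u : X | ‖u‖ ≤ 1 ∧ (√(1 + ‖u‖ ^ 2))⁻¹ • u ∈ B} with hD
  have hDm : MeasurableSet D :=
    (measurableSet_le measurable_norm measurable_const).inter
      (hB.preimage (by fun_prop : Measurable fun u : X => (√(1 + ‖u‖ ^ 2))⁻¹ • u))
  have hsm : MeasurableSet {ω : Metric.sphere (0 : E) 1 | ‖(e ω).1‖ ≤ ‖(e ω).2‖ ∧ (e ω).1 ∈ B} := by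
    have h1 : Measurable fun ω : Metric.sphere (0 : E) 1 => e ω :=
      e.continuous.measurable.comp measurable_subtype_coe
    exact (measurableSet_le h1.fst.norm h1.snd.norm).inter (h1.fst hB)
  -- The measure `toSphere` is the dimension times the volume of the cone over a set, and `Q`
  -- contains this cone. The quotient `u = ‖p.2‖⁻¹ • p.1` is constant on rays, and on the sphere `1
  -- + ‖u‖² = ‖p.2‖⁻²`, so the central projection of `u` is the first component. The slice of `Q`
  -- over `z ≠ 0` in the unit ball is `D` scaled by `‖z‖ < 1`.
  set Q : Set (X × Y) := {p | p.2 ∈ Metric.ball (0 : Y) 1 ∧ p.2 ≠ 0 ∧ ‖p.2‖⁻¹ • p.1 ∈ D} with hQ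
  have hQm : MeasurableSet Q := by
    refine (measurable_snd Metric.isOpen_ball.measurableSet).inter
      ((measurable_snd (measurableSet_singleton (0 : Y)).compl).inter ?_)
    exact (by fun_prop : Measurable fun p : X × Y => ‖p.2‖⁻¹ • p.1) hDm
  have hnorm : ∀ x : E, ‖x‖ ^ 2 = ‖(e x).1‖ ^ 2 + ‖(e x).2‖ ^ 2 := fun x => by
    rw [← real_inner_self_eq_norm_sq, hin, real_inner_self_eq_norm_sq, real_inner_self_eq_norm_sq]
  rw [Measure.toSphere_apply' _ hsm]
  have hsub : Set.Ioo (0 : ℝ) 1 • ((↑) '' {ω : Metric.sphere (0 : E) 1 |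
      ‖(e ω).1‖ ≤ ‖(e ω).2‖ ∧ (e ω).1 ∈ B}) ⊆ e ⁻¹' Q := by
    rintro _ ⟨t, ht, _, ⟨ω, ⟨hω1, hω2⟩, rfl⟩, rfl⟩
    have hω : ‖(e ω).1‖ ^ 2 + ‖(e ω).2‖ ^ 2 = 1 := by
      rw [← hnorm, norm_eq_of_mem_sphere, one_pow]
    have hz0 : 0 < ‖(e ω).2‖ := by
      by_contra h
      have h0 : ‖(e ω).2‖ = 0 := le_antisymm (not_lt.1 h) (norm_nonneg _)
      have h1 : ‖(e ω).1‖ = 0 := le_antisymm (hω1.trans h0.le) (norm_nonneg _)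
      rw [h0, h1] at hω
      norm_num at hω
    have hz1 : ‖(e ω).2‖ ≤ 1 := by nlinarith [norm_nonneg (e ω).1, norm_nonneg (e ω).2]
    simp only [Set.mem_preimage, hQ, Set.mem_ofPred_eq, map_smul, Prod.smul_fst, Prod.smul_snd,
      mem_ball_zero_iff]
    have hne : t • (e ω).2 ≠ 0 := smul_ne_zero ht.1.ne' (norm_pos_iff.1 hz0)
    refine ⟨?_, hne, ?_⟩
    · rw [norm_smul, Real.norm_of_nonneg ht.1.le]
      calc t * ‖(e ω).2‖ ≤ t * 1 := by gcongr; exact ht.1.le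
        _ < 1 := by linarith [ht.2]
    · have e1 : ‖t • (e ω).2‖⁻¹ • t • (e ω).1 = ‖(e ω).2‖⁻¹ • (e ω).1 := by
        rw [norm_smul, Real.norm_of_nonneg ht.1.le, smul_smul]
        congr 1
        have := ht.1.ne'
        field_simp
      have e2 : ‖‖(e ω).2‖⁻¹ • (e ω).1‖ = ‖(e ω).1‖ / ‖(e ω).2‖ := by
        rw [norm_smul, norm_inv, norm_norm, inv_mul_eq_div]
      rw [e1, hD, Set.mem_ofPred_eq, e2]
      refine ⟨(div_le_one hz0).2 hω1, ?_⟩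
      have e3 : 1 + (‖(e ω).1‖ / ‖(e ω).2‖) ^ 2 = (‖(e ω).2‖⁻¹) ^ 2 := by
        have : ‖(e ω).1‖ ^ 2 = 1 - ‖(e ω).2‖ ^ 2 := by linarith
        rw [div_pow, this]
        field_simp
        ring
      rw [e3, Real.sqrt_sq (by positivity), inv_inv, smul_smul, mul_inv_cancel₀ hz0.ne', one_smul]
      exact hω2
  have hQle : volume Q ≤ volume (Metric.ball (0 : Y) 1) * (K * volume B) := by
    rw [Measure.volume_eq_prod, Measure.prod_apply_symm hQm]
    have h1 : ∀ z : Y, volume ((fun y => (y, z)) ⁻¹' Q)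
        ≤ (Metric.ball (0 : Y) 1).indicator (fun _ => K * volume B) z := by
      intro z
      by_cases hz : z ∈ Metric.ball (0 : Y) 1 ∧ z ≠ 0
      · rw [Set.indicator_of_mem hz.1]
        have hz0 : 0 < ‖z‖ := norm_pos_iff.2 hz.2
        have hz1 : ‖z‖ < 1 := mem_ball_zero_iff.1 hz.1
        have e1 : (fun y => (y, z)) ⁻¹' Q = (fun y : X => ‖z‖⁻¹ • y) ⁻¹' D := by
          ext y
          simp only [Set.mem_preimage, hQ, Set.mem_ofPred_eq]
          exact ⟨fun h => h.2.2, fun h => ⟨hz.1, hz.2, h⟩⟩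
        rw [e1, Measure.addHaar_preimage_smul _ (inv_ne_zero hz0.ne')]
        calc _ ≤ 1 * volume D := by
              gcongr
              rw [← ENNReal.ofReal_one]
              refine ENNReal.ofReal_le_ofReal ?_
              rw [inv_pow, inv_inv, abs_of_pos (by positivity)]
              exact pow_le_one₀ hz0.le hz1.le
          _ ≤ K * volume B := by rw [one_mul]; exact hK B
      · have e1 : (fun y : X => (y, z)) ⁻¹' Q = ∅ := by
          ext y
          simp only [Set.mem_preimage, hQ, Set.mem_ofPred_eq, Set.mem_empty_iff_false, iff_false]
          exact fun h => hz ⟨h.1, h.2.1⟩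
        rw [e1, measure_empty]
        exact zero_le
    refine (lintegral_mono h1).trans ?_
    rw [lintegral_indicator Metric.isOpen_ball.measurableSet, lintegral_const,
      Measure.restrict_apply_univ, mul_comm]
  have hcone := (measure_mono hsub).trans
    ((he.measure_preimage hQm.nullMeasurableSet).trans_le hQle)
  refine (mul_le_mul_right hcone _).trans (le_of_eq ?_)
  rw [ENNReal.coe_mul, ENNReal.coe_mul, ENNReal.coe_toNNReal hbt, ENNReal.coe_natCast]
  ring

/-- The estimate on the part of the sphere where the second frequency dominates. -/
theorem exists_setLIntegral_fourier_le_of_fst_le_snd (e : E ≃L[ℝ] X × Y)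
    (he : MeasurePreserving e)
    (hin : ∀ x y, inner ℝ x y = inner ℝ (e x).1 (e y).1 + inner ℝ (e x).2 (e y).2)
    {n m : ℕ} (hn : Module.finrank ℝ Y = n) (hm : 1 ≤ m) (hmn : m ≤ n) :
    ∃ C : ℝ≥0, ∀ f : E → ℂ, Integrable f →
      (∀ (V : Y ≃ₗᵢ[ℝ] Y) (x y), f (e.symm (x, V y)) = f (e.symm (x, y))) →
      ∀ F : Set (Metric.sphere (0 : E) 1), MeasurableSet F →
      ∫⁻ ω in F ∩ {ω | ‖(e ω).1‖ ≤ ‖(e ω).2‖},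
          ‖∫ x, f x * Complex.exp (-Complex.I * ((inner ℝ (ω : E) x : ℝ) : ℂ))‖ₑ
            ∂(volume : Measure E).toSphere
        ≤ C * (volume : Measure E).toSphere F ^ (((m : ℝ) + 1) / (2 * m)) *
          ∫⁻ t in Set.Ioi (0 : ℝ), volume {x | t < ‖f x‖} ^ (((m : ℝ) + 1) / (2 * m)) := by
  obtain ⟨A, hA⟩ := exists_toSphere_le_of_fst_le_snd e he hin
  obtain ⟨C, hC⟩ := exists_lintegral_waveIntegral_le (X := X) (Y := Y) hn hm hmn A
  refine ⟨C, fun f hf hsym F hF => ?_⟩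
  have hem : MeasurableEmbedding e := e.toHomeomorph.measurableEmbedding
  have hes : MeasurePreserving e.symm := by
    refine he.symm (e := e.toHomeomorph.toMeasurableEquiv)
  have hesm : MeasurableEmbedding e.symm := e.symm.toHomeomorph.measurableEmbedding
  have h1 : Measurable fun ω : Metric.sphere (0 : E) 1 => e ω :=
    e.continuous.measurable.comp measurable_subtype_coe
  set R : Set (Metric.sphere (0 : E) 1) := {ω | ‖(e ω).1‖ ≤ ‖(e ω).2‖} with hR
  have hRm : MeasurableSet R := measurableSet_le h1.fst.norm h1.snd.norm
  set σ := (volume : Measure E).toSphere with hσ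
  -- The set `F` enters only through this measure: its total mass is at most `σ F`, and its first
  -- marginal is controlled uniformly in `F`.
  set ν : Measure (X × Y) := (σ.restrict (F ∩ R)).map fun ω : Metric.sphere (0 : E) 1 => e ω with hν
  have hνF : ν Set.univ ≤ σ F := by
    rw [hν, Measure.map_apply h1 .univ, Set.preimage_univ, Measure.restrict_apply_univ]
    exact measure_mono Set.inter_subset_left
  have : IsFiniteMeasure ν := ⟨hνF.trans_lt (measure_lt_top _ _)⟩
  have hν1 : ∀ᵐ ξ ∂ν, 1 / 2 ≤ ‖ξ.2‖ := by
    rw [hν, ae_map_iff h1.aemeasurable (measurableSet_le measurable_const measurable_snd.norm)]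
    refine (ae_restrict_mem (hF.inter hRm)).mono fun ω hω => ?_
    have h2 : ‖(e ω).1‖ ≤ ‖(e ω).2‖ := hω.2
    have h3 : ‖(e ω).1‖ ^ 2 + ‖(e ω).2‖ ^ 2 = 1 := by
      rw [← real_inner_self_eq_norm_sq, ← real_inner_self_eq_norm_sq, ← hin,
        real_inner_self_eq_norm_sq, norm_eq_of_mem_sphere, one_pow]
    nlinarith [norm_nonneg (e ω).1, norm_nonneg (e ω).2]
  have hν2 : ν.map Prod.fst ≤ A • volume := by
    refine Measure.le_iff.2 fun B hB => ?_
    rw [hν, Measure.map_map measurable_fst h1, Measure.map_apply (measurable_fst.comp h1) hB,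
      Measure.restrict_apply (measurable_fst.comp h1 hB), Measure.smul_apply]
    refine (measure_mono ?_).trans (hA B hB)
    rintro ω ⟨hω1, hω2⟩
    exact ⟨hω2.2, hω1⟩
  set g : X × Y → ℂ := fun p => f (e.symm p) with hg
  have hgi : Integrable g := (hes.integrable_comp_emb hesm).2 hf
  have hwave : ∀ ω : E, waveIntegral g (e ω)
      = ∫ x, f x * Complex.exp (-Complex.I * ((inner ℝ ω x : ℝ) : ℂ)) := by
    intro ω
    rw [waveIntegral, ← he.integral_comp hem]
    refine integral_congr_ae (.of_forall fun x => ?_)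
    simp only [hg, ContinuousLinearEquiv.symm_apply_apply, ← hin]
  have hdist : ∀ t : ℝ, volume {p | t < ‖g p‖} = volume {x | t < ‖f x‖} := by
    intro t
    rw [← hes.measure_preimage_emb hesm]
    rfl
  have hmain := hC ν hν1 hν2 g hgi fun V x y => hsym V x y
  rw [hν, lintegral_map (stronglyMeasurable_waveIntegral hgi.1).enorm h1, ← hν] at hmain
  simp only [hwave, hdist] at hmain
  refine hmain.trans ?_
  gcongr

end SphereChart

/-! ### Block symmetry, and the estimate on the whole sphere. -/

section BlockSpace

/-- The identification `ℝ^d = ℝ^{d-k} × ℝ^k`. -/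
noncomputable abbrev blockEquiv (d k : ℕ) :
    BlockSpace d k ≃L[ℝ] EuclideanSpace ℝ (Fin (d - k)) × EuclideanSpace ℝ (Fin k) :=
  EuclideanSpace.sumEquivProd

theorem measurePreserving_blockEquiv (d k : ℕ) : MeasurePreserving (blockEquiv d k) :=
  (WithLp.volume_preserving_ofLp (EuclideanSpace ℝ (Fin (d - k))) (EuclideanSpace ℝ (Fin k))).comp
    (LinearIsometryEquiv.measurePreserving
      (PiLp.sumPiLpEquivProdLpPiLp (𝕜 := ℝ) 2 fun _ : Fin (d - k) ⊕ Fin k => ℝ))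

theorem inner_eq_inner_blockEquiv {d k : ℕ} (x y : BlockSpace d k) :
    inner ℝ x y = inner ℝ (blockEquiv d k x).1 (blockEquiv d k y).1
      + inner ℝ (blockEquiv d k x).2 (blockEquiv d k y).2 := by
  simp only [PiLp.inner_apply, Fintype.sum_sum_type]
  rfl

theorem exists_mem_orthogonalGroup_mulVec {n : ℕ}
    (V : EuclideanSpace ℝ (Fin n) ≃ₗᵢ[ℝ] EuclideanSpace ℝ (Fin n)) :
    ∃ M ∈ Matrix.orthogonalGroup (Fin n) ℝ, ∀ y, M.mulVec y.ofLp = (V y).ofLp := by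
  refine ⟨_, V.toMatrix_mem_unitaryGroup (EuclideanSpace.basisFun (Fin n) ℝ)
    (EuclideanSpace.basisFun (Fin n) ℝ), fun y => ?_⟩
  have h := LinearMap.toMatrix_mulVec_repr (EuclideanSpace.basisFun (Fin n) ℝ).toBasis
    (EuclideanSpace.basisFun (Fin n) ℝ).toBasis (V.toLinearEquiv : _ →ₗ[ℝ] _) y
  have e : ∀ z : EuclideanSpace ℝ (Fin n),
      ((EuclideanSpace.basisFun (Fin n) ℝ).toBasis.repr z : Fin n → ℝ) = z.ofLp := by
    intro z; ext i; simp
  rw [e, e] at h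
  exact h

theorem toEuclideanLin_fromBlocks_apply {d k : ℕ} {M : Matrix (Fin (d - k)) (Fin (d - k)) ℝ}
    {N : Matrix (Fin k) (Fin k) ℝ} {y y' : EuclideanSpace ℝ (Fin (d - k))}
    {z z' : EuclideanSpace ℝ (Fin k)} (hM : M.mulVec y.ofLp = y'.ofLp)
    (hN : N.mulVec z.ofLp = z'.ofLp) :
    Matrix.toEuclideanLin (Matrix.fromBlocks M 0 0 N) ((blockEquiv d k).symm (y, z))
      = (blockEquiv d k).symm (y', z') := by
  have e : ((blockEquiv d k).symm (y, z)).ofLp = Sum.elim y.ofLp z.ofLp := by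
    ext i; rcases i with i | i <;> rfl
  ext i
  rw [Matrix.toLpLin_apply, e, Matrix.fromBlocks_mulVec]
  simp only [Sum.elim_comp_inl, Sum.elim_comp_inr, Matrix.zero_mulVec, add_zero, zero_add, hM, hN]
  rcases i with i | i <;> rfl

theorem IsBlockSymmetric.apply_snd {d k : ℕ} {f : BlockSpace d k → ℂ} (hf : IsBlockSymmetric f)
    (V : EuclideanSpace ℝ (Fin k) ≃ₗᵢ[ℝ] EuclideanSpace ℝ (Fin k))
    (y : EuclideanSpace ℝ (Fin (d - k))) (z : EuclideanSpace ℝ (Fin k)) :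
    f ((blockEquiv d k).symm (y, V z)) = f ((blockEquiv d k).symm (y, z)) := by
  obtain ⟨N, hN, hV⟩ := exists_mem_orthogonalGroup_mulVec V
  have h := congrFun (hf 1 (one_mem _) N hN) ((blockEquiv d k).symm (y, z))
  rwa [Function.comp_apply,
    toEuclideanLin_fromBlocks_apply (Matrix.one_mulVec _) (hV z)] at h

theorem IsBlockSymmetric.apply_fst {d k : ℕ} {f : BlockSpace d k → ℂ} (hf : IsBlockSymmetric f)
    (V : EuclideanSpace ℝ (Fin (d - k)) ≃ₗᵢ[ℝ] EuclideanSpace ℝ (Fin (d - k)))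
    (y : EuclideanSpace ℝ (Fin (d - k))) (z : EuclideanSpace ℝ (Fin k)) :
    f ((blockEquiv d k).symm (V y, z)) = f ((blockEquiv d k).symm (y, z)) := by
  obtain ⟨N, hN, hV⟩ := exists_mem_orthogonalGroup_mulVec V
  have h := congrFun (hf N hN 1 (one_mem _)) ((blockEquiv d k).symm (y, z))
  rwa [Function.comp_apply,
    toEuclideanLin_fromBlocks_apply (hV y) (Matrix.one_mulVec _)] at h

theorem IsBlockSymmetric.sub {d k : ℕ} {f g : BlockSpace d k → ℂ} (hf : IsBlockSymmetric f)
    (hg : IsBlockSymmetric g) : IsBlockSymmetric (f - g) := by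
  intro U hU V hV
  rw [Pi.sub_comp, hf U hU V hV, hg U hU V hV]

/-- Block diagonal orthogonal matrices preserve the norm. -/
theorem norm_toEuclideanLin_fromBlocks {d k : ℕ} {U : Matrix (Fin (d - k)) (Fin (d - k)) ℝ}
    (hU : U ∈ Matrix.orthogonalGroup (Fin (d - k)) ℝ) {V : Matrix (Fin k) (Fin k) ℝ}
    (hV : V ∈ Matrix.orthogonalGroup (Fin k) ℝ) (x : BlockSpace d k) :
    ‖Matrix.toEuclideanLin (Matrix.fromBlocks U 0 0 V) x‖ = ‖x‖ := by
  have hW : (Matrix.fromBlocks U 0 0 V).transpose * Matrix.fromBlocks U 0 0 V = 1 := by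
    have h1 : U.transpose * U = 1 := Matrix.mem_unitaryGroup_iff'.1 hU
    have h2 : V.transpose * V = 1 := Matrix.mem_unitaryGroup_iff'.1 hV
    simp [Matrix.fromBlocks_transpose, Matrix.fromBlocks_multiply, h1, h2]
  have hsq : ∀ y : BlockSpace d k, ‖y‖ ^ 2 = y.ofLp ⬝ᵥ y.ofLp := fun y => by
    rw [EuclideanSpace.norm_sq_eq, dotProduct]
    exact Finset.sum_congr rfl fun i _ => by rw [Real.norm_eq_abs, sq_abs, sq]
  rw [← sq_eq_sq₀ (norm_nonneg _) (norm_nonneg _), hsq, hsq, Matrix.toLpLin_apply]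
  simp only
  rw [Matrix.dotProduct_mulVec, ← Matrix.mulVec_transpose, Matrix.mulVec_mulVec, hW,
    Matrix.one_mulVec]

/-- The strong type form of the restriction estimate for integrable symmetric functions. -/
theorem exists_setLIntegral_fourierHat_le {d k m : ℕ} (hm1 : 1 ≤ m) (hmd : m ≤ d - k)
    (hmk : m ≤ k) :
    ∃ C : ℝ≥0, ∀ f : BlockSpace d k → ℂ, IsBlockSymmetric f → Integrable f →
      ∀ F : Set (BlockSphere d k), MeasurableSet F →
      ∫⁻ ω in F, ‖fourierHat f ω‖ₑ ∂surfaceMeasure d k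
        ≤ C * surfaceMeasure d k F ^ (((m : ℝ) + 1) / (2 * m)) *
          ∫⁻ t in Set.Ioi (0 : ℝ), volume {x | t < ‖f x‖} ^ (((m : ℝ) + 1) / (2 * m)) := by
  obtain ⟨C₁, hC₁⟩ := exists_setLIntegral_fourier_le_of_fst_le_snd (blockEquiv d k)
    (measurePreserving_blockEquiv d k) inner_eq_inner_blockEquiv (n := k) (by simp) hm1 hmk
  -- The other half of the sphere, with the blocks interchanged. Serving both halves with one
  -- exponent requires `m` to be at most each dimension.
  obtain ⟨C₂, hC₂⟩ := exists_setLIntegral_fourier_le_of_fst_le_snd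
    ((blockEquiv d k).trans (ContinuousLinearEquiv.prodComm ℝ _ _))
    (Measure.measurePreserving_swap.comp (measurePreserving_blockEquiv d k))
    (fun x y => (inner_eq_inner_blockEquiv x y).trans (add_comm _ _)) (n := d - k) (by simp)
    hm1 hmd
  refine ⟨C₁ + C₂, fun f hsym hf F hF => ?_⟩
  have h1 := hC₁ f hf (fun V x y => hsym.apply_snd V x y) F hF
  have h2 := hC₂ f hf (fun V x y => hsym.apply_fst V y x) F hF
  have hcover : F ⊆ (F ∩ {ω | ‖(blockEquiv d k ω).1‖ ≤ ‖(blockEquiv d k ω).2‖})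
      ∪ (F ∩ {ω | ‖(blockEquiv d k ω).2‖ ≤ ‖(blockEquiv d k ω).1‖}) := by
    intro ω hω
    rcases le_total ‖(blockEquiv d k ω).1‖ ‖(blockEquiv d k ω).2‖ with h | h
    · exact Or.inl ⟨hω, h⟩
    · exact Or.inr ⟨hω, h⟩
  refine (lintegral_mono_set hcover).trans ((lintegral_union_le _ _ _).trans ?_)
  refine (add_le_add h1 h2).trans (le_of_eq ?_)
  rw [ENNReal.coe_add, surfaceMeasure]
  ring

end BlockSpace

/-! ### Lorentz functionals, weak type bounds and truncation. -/

section Lorentz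

open Filter Topology

theorem eLorentzNorm_one {α : Type*} [MeasurableSpace α] (f : α → ℂ) (p : ℝ) (μ : Measure α) :
    eLorentzNorm f p 1 μ
      = ENNReal.ofReal p * ∫⁻ t in Set.Ioi (0 : ℝ), μ {x | t < ‖f x‖} ^ (1 / p) := by
  rw [eLorentzNorm, if_neg ENNReal.one_ne_top, ENNReal.toReal_one, div_one, ENNReal.rpow_one]
  congr 1
  refine setLIntegral_congr_fun measurableSet_Ioi fun t ht => ?_
  simp only [ENNReal.rpow_one]
  rw [mul_comm, ENNReal.mul_div_cancel_right (ENNReal.ofReal_pos.2 ht).ne' ENNReal.ofReal_ne_top]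

/-- Integral bounds over all measurable sets give a weak type bound. -/
theorem eLorentzNorm_top_le_of_setLIntegral_le {α : Type*} [MeasurableSpace α] {μ : Measure α}
    [IsFiniteMeasure μ] {h : α → ℂ} (hh : AEStronglyMeasurable h μ) {K : ℝ≥0∞} {r p : ℝ}
    (hp : 0 < p) (hpr : 1 / p = 1 - r)
    (hK : ∀ F, MeasurableSet F → ∫⁻ x in F, ‖h x‖ₑ ∂μ ≤ K * μ F ^ r) :
    eLorentzNorm h p ∞ μ ≤ K := by
  rw [eLorentzNorm, if_pos rfl]
  refine iSup_le fun t => ?_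
  set h' := hh.mk h
  have heq : h =ᵐ[μ] h' := hh.ae_eq_mk
  -- Testing on the superlevel set and applying Chebyshev gives `t μ(F) ≤ K μ(F)^r`; it remains to
  -- divide by `μ(F)^r`, which is finite and nonzero.
  set F : Set α := {x | (t : ℝ) < ‖h' x‖} with hF
  have hFm : MeasurableSet F :=
    measurableSet_lt measurable_const hh.stronglyMeasurable_mk.measurable.norm
  have hmeas : μ {x | (t : ℝ) < ‖h x‖} = μ F := by
    refine measure_congr ?_
    filter_upwards [heq] with x hx
    refine propext ?_
    change (t : ℝ) < ‖h x‖ ↔ (t : ℝ) < ‖h' x‖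
    rw [hx]
  rw [hmeas]
  rcases eq_or_ne (μ F) 0 with h0 | h0
  · rw [h0, ENNReal.zero_rpow_of_pos (by positivity), mul_zero]
    exact zero_le
  have hfin : μ F ≠ ∞ := measure_ne_top _ _
  have h1 : (t : ℝ≥0∞) * μ F ≤ K * μ F ^ r := by
    refine le_trans ?_ (hK F hFm)
    rw [← setLIntegral_const]
    have : ∫⁻ x in F, ‖h x‖ₑ ∂μ = ∫⁻ x in F, ‖h' x‖ₑ ∂μ := by
      refine lintegral_congr_ae (ae_restrict_of_ae ?_)
      filter_upwards [heq] with x hx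
      rw [hx]
    rw [this]
    refine setLIntegral_mono' hFm fun x hx => ?_
    rw [← ofReal_norm, ← ENNReal.ofReal_coe_nnreal]
    exact ENNReal.ofReal_le_ofReal (le_of_lt hx)
  have h2 : μ F ^ (1 / p) = μ F * μ F ^ (-r) := by
    conv_rhs => rw [← ENNReal.rpow_one (μ F), ← ENNReal.rpow_mul, one_mul]
    rw [← ENNReal.rpow_add _ _ h0 hfin, hpr, sub_eq_add_neg]
  calc (t : ℝ≥0∞) * μ F ^ (1 / p) = (t * μ F) * μ F ^ (-r) := by rw [h2, mul_assoc]
    _ ≤ (K * μ F ^ r) * μ F ^ (-r) := by gcongr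
    _ = K := by
      rw [mul_assoc, ← ENNReal.rpow_add _ _ h0 hfin, add_neg_cancel, ENNReal.rpow_zero, mul_one]

variable {E : Type*} [NormedAddCommGroup E]

/-- The truncation of a function to a ball about the origin. -/
noncomputable def ballTruncation (N : ℕ) (f : E → ℂ) : E → ℂ :=
  (Metric.ball (0 : E) N).indicator f

theorem norm_ballTruncation_le (N : ℕ) (f : E → ℂ) (x : E) : ‖ballTruncation N f x‖ ≤ ‖f x‖ :=
  norm_indicator_le_norm_self _ _

theorem ballTruncation_add (N : ℕ) (f g : E → ℂ) :
    ballTruncation N (f + g) = ballTruncation N f + ballTruncation N g :=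
  Set.indicator_add' _ _ _

theorem ballTruncation_smul (N : ℕ) (c : ℂ) (f : E → ℂ) :
    ballTruncation N (c • f) = c • ballTruncation N f :=
  Set.indicator_const_smul _ c f

theorem norm_ballTruncation_sub_le {N n m : ℕ} (hn : N ≤ n) (hm : N ≤ m) (f : E → ℂ) (x : E) :
    ‖(ballTruncation n f - ballTruncation m f) x‖ ≤ ‖(f - ballTruncation N f) x‖ := by
  have hN : ∀ {k : ℕ}, N ≤ k → x ∈ Metric.ball (0 : E) N → x ∈ Metric.ball (0 : E) k :=
    fun h hx => Metric.ball_subset_ball (by exact_mod_cast h) hx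
  simp only [Pi.sub_apply, ballTruncation]
  by_cases h : x ∈ Metric.ball (0 : E) N
  · simp [Set.indicator_of_mem h, Set.indicator_of_mem (hN hn h), Set.indicator_of_mem (hN hm h)]
  · rw [Set.indicator_of_notMem h, sub_zero]
    by_cases h1 : x ∈ Metric.ball (0 : E) n <;> by_cases h2 : x ∈ Metric.ball (0 : E) m <;>
      simp [Set.indicator, h1, h2]

/-- The Lorentz functional `∫₀^∞ μ{|f| > t}^r dt`. -/
noncomputable def distIntegral {α : Type*} [MeasurableSpace α] (r : ℝ) (μ : Measure α) (f : α → ℂ) : ℝ≥0∞ :=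
  ∫⁻ t in Set.Ioi (0 : ℝ), μ {x | t < ‖f x‖} ^ r

theorem distIntegral_mono {α : Type*} [MeasurableSpace α] {r : ℝ} (hr : 0 ≤ r) {μ : Measure α} {f g : α → ℂ}
    (h : ∀ x, ‖f x‖ ≤ ‖g x‖) : distIntegral r μ f ≤ distIntegral r μ g :=
  lintegral_mono fun t => ENNReal.rpow_le_rpow
    (measure_mono fun x (hx : t < ‖f x‖) => hx.trans_le (h x)) hr

theorem measurable_distribution_rpow {α : Type*} [MeasurableSpace α] {r : ℝ} (hr : 0 ≤ r) (μ : Measure α) (f : α → ℂ) :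
    Measurable fun t : ℝ => μ {x | t < ‖f x‖} ^ r := by
  refine Antitone.measurable fun s t hst => ?_
  exact ENNReal.rpow_le_rpow (measure_mono fun x (hx : t < ‖f x‖) => hst.trans_lt hx) hr

variable [MeasurableSpace E] [BorelSpace E]

/-- Dominated convergence in `t`: almost every superlevel set of `f` has finite measure, so its part
outside the ball of radius `N` has measure tending to zero. -/
theorem tendsto_distIntegral_sub_ballTruncation {r : ℝ} (hr : 0 < r) {μ : Measure E} {f : E → ℂ}
    (hf : AEStronglyMeasurable f μ) (hfin : distIntegral r μ f < ∞) :
    Tendsto (fun N => distIntegral r μ (f - ballTruncation N f)) atTop (𝓝 0) := by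
  have hlim : Tendsto (fun N : ℕ => ∫⁻ t in Set.Ioi (0 : ℝ),
      μ {x | t < ‖(f - ballTruncation N f) x‖} ^ r) atTop
      (𝓝 (∫⁻ _ in Set.Ioi (0 : ℝ), 0)) := by
    refine tendsto_lintegral_of_dominated_convergence
      (fun t => μ {x | t < ‖f x‖} ^ r) (fun N => measurable_distribution_rpow hr.le μ _)
      (fun N => ?_) hfin.ne ?_
    · refine .of_forall fun t => ENNReal.rpow_le_rpow (measure_mono fun x hx => ?_) hr.le
      have hx' : t < ‖(f - ballTruncation N f) x‖ := hx
      refine hx'.trans_le ?_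
      simp only [Pi.sub_apply, ballTruncation]
      by_cases h : x ∈ Metric.ball (0 : E) N <;> simp [Set.indicator, h]
    · have hae := ae_lt_top (measurable_distribution_rpow hr.le μ f) hfin.ne
      filter_upwards [hae, ae_restrict_mem measurableSet_Ioi] with t ht ht0
      have ht0 : 0 < t := ht0
      have hfin_t : μ {x | t < ‖f x‖} ≠ ∞ := fun h => by
        simp only [h, ENNReal.top_rpow_of_pos hr, lt_self_iff_false] at ht
      have hset : ∀ N : ℕ, {x | t < ‖(f - ballTruncation N f) x‖}
          = {x | t < ‖f x‖} ∩ (Metric.ball (0 : E) N)ᶜ := by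
        intro N
        ext x
        simp only [Set.mem_ofPred_eq, Set.mem_inter_iff, Set.mem_compl_iff, Pi.sub_apply,
          ballTruncation]
        by_cases h : x ∈ Metric.ball (0 : E) N <;> simp [Set.indicator, h, ht0.le]
      have hnull : NullMeasurableSet {x | t < ‖f x‖} μ :=
        nullMeasurableSet_lt aemeasurable_const hf.norm.aemeasurable
      have h1 : Tendsto (fun N : ℕ => μ ({x | t < ‖f x‖} ∩ (Metric.ball (0 : E) N)ᶜ)) atTop
          (𝓝 (μ (⋂ N : ℕ, {x | t < ‖f x‖} ∩ (Metric.ball (0 : E) N)ᶜ))) := by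
        refine tendsto_measure_iInter_atTop
          (fun N => hnull.inter Metric.isOpen_ball.measurableSet.compl.nullMeasurableSet) ?_
          ⟨0, measure_ne_top_of_subset Set.inter_subset_left hfin_t⟩
        intro n m hnm
        refine Set.inter_subset_inter_right _ (Set.compl_subset_compl.2 ?_)
        exact Metric.ball_subset_ball (by exact_mod_cast hnm)
      have h2 : (⋂ N : ℕ, {x | t < ‖f x‖} ∩ (Metric.ball (0 : E) N)ᶜ) = ∅ := by
        refine Set.eq_empty_of_forall_notMem fun x hx => ?_
        obtain ⟨N, hN⟩ := exists_nat_gt ‖x‖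
        exact (Set.mem_iInter.1 hx N).2 (mem_ball_zero_iff.2 hN)
      rw [h2, measure_empty] at h1
      simp_rw [hset]
      have := (ENNReal.continuous_rpow_const (y := r)).continuousAt.tendsto.comp h1
      rwa [ENNReal.zero_rpow_of_pos hr] at this
  simpa [distIntegral] using hlim

/-- On a ball superlevel sets have measure at most `V`, so `w = w^(1-r) w^r` bounds the `L¹` norm by
the Lorentz functional. -/
theorem integrable_ballTruncation [ProperSpace E] {r : ℝ} (hr : 0 < r) (hr1 : r ≤ 1)
    {μ : Measure E} [IsFiniteMeasureOnCompacts μ] {f : E → ℂ}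
    (hf : AEStronglyMeasurable f μ) (hfin : distIntegral r μ f < ∞) (N : ℕ) :
    Integrable (ballTruncation N f) μ := by
  have hm : AEStronglyMeasurable (ballTruncation N f) μ :=
    hf.indicator Metric.isOpen_ball.measurableSet
  refine ⟨hm, ?_⟩
  have h1 : ∫⁻ x, ‖ballTruncation N f x‖ₑ ∂μ
      = ∫⁻ t in Set.Ioi (0 : ℝ), μ {x | t < ‖ballTruncation N f x‖} := by
    simp_rw [← ofReal_norm]
    exact lintegral_eq_lintegral_meas_lt μ (.of_forall fun x => norm_nonneg _) hm.norm.aemeasurable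
  set V := μ (Metric.ball (0 : E) N) with hV
  have hVfin : V < ∞ := measure_ball_lt_top
  rw [HasFiniteIntegral, h1]
  calc ∫⁻ t in Set.Ioi (0 : ℝ), μ {x | t < ‖ballTruncation N f x‖}
      ≤ ∫⁻ t in Set.Ioi (0 : ℝ), V ^ (1 - r) * μ {x | t < ‖f x‖} ^ r := by
        refine setLIntegral_mono' measurableSet_Ioi fun t ht => ?_
        have ht0 : (0 : ℝ) < t := ht
        set w := μ {x | t < ‖ballTruncation N f x‖} with hw
        have hw1 : w ≤ V := measure_mono fun x hx => by
          by_contra h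
          have hx' : t < ‖ballTruncation N f x‖ := hx
          rw [ballTruncation, Set.indicator_of_notMem h, norm_zero] at hx'
          exact absurd hx' ht0.not_gt
        have hw2 : w ≤ μ {x | t < ‖f x‖} :=
          measure_mono fun x (hx : t < _) => hx.trans_le (norm_ballTruncation_le N f x)
        calc w = w ^ (1 - r) * w ^ r := by
              rw [← ENNReal.rpow_add_of_nonneg _ _ (by linarith) hr.le, sub_add_cancel,
                ENNReal.rpow_one]
          _ ≤ _ := mul_le_mul' (ENNReal.rpow_le_rpow hw1 (by linarith))
              (ENNReal.rpow_le_rpow hw2 hr.le)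
    _ = V ^ (1 - r) * distIntegral r μ f :=
        lintegral_const_mul _ (measurable_distribution_rpow hr.le μ f)
    _ < ∞ := ENNReal.mul_lt_top (ENNReal.rpow_lt_top_of_nonneg (by linarith) hVfin.ne) hfin

end Lorentz

/-! ### The restriction operator as a limit of transforms of truncations. -/

section Restriction

open Filter Topology

variable {d k : ℕ}

instance isFiniteMeasure_surfaceMeasure : IsFiniteMeasure (surfaceMeasure d k) := by
  unfold surfaceMeasure
  infer_instance

theorem integrable_mul_exp_inner {f : BlockSpace d k → ℂ} (hf : Integrable f)
    (ξ : BlockSpace d k) :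
    Integrable fun x => f x * Complex.exp (-Complex.I * ((inner ℝ ξ x : ℝ) : ℂ)) :=
  hf.mul_bdd (c := 1) (Measurable.aestronglyMeasurable (by fun_prop))
    (.of_forall fun z => (norm_exp_neg_I_mul _).le)

theorem fourierHat_add {f g : BlockSpace d k → ℂ} (hf : Integrable f) (hg : Integrable g)
    (ξ : BlockSpace d k) : fourierHat (f + g) ξ = fourierHat f ξ + fourierHat g ξ := by
  simp only [fourierHat]
  rw [← integral_add (integrable_mul_exp_inner hf ξ) (integrable_mul_exp_inner hg ξ)]
  simp only [Pi.add_apply, add_mul]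

theorem fourierHat_smul (c : ℂ) (f : BlockSpace d k → ℂ) (ξ : BlockSpace d k) :
    fourierHat (c • f) ξ = c * fourierHat f ξ := by
  simp only [fourierHat]
  rw [← integral_const_mul]
  simp only [Pi.smul_apply, smul_eq_mul, mul_assoc]

theorem fourierHat_sub {f g : BlockSpace d k → ℂ} (hf : Integrable f) (hg : Integrable g)
    (ξ : BlockSpace d k) : fourierHat (f - g) ξ = fourierHat f ξ - fourierHat g ξ := by
  simp only [fourierHat]
  rw [← integral_sub (integrable_mul_exp_inner hf ξ) (integrable_mul_exp_inner hg ξ)]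
  simp only [Pi.sub_apply, sub_mul]

theorem enorm_fourierHat_le (f : BlockSpace d k → ℂ) (ξ : BlockSpace d k) :
    ‖fourierHat f ξ‖ₑ ≤ ∫⁻ x, ‖f x‖ₑ := by
  refine (enorm_integral_le_lintegral_enorm _).trans (le_of_eq ?_)
  refine lintegral_congr fun x => ?_
  rw [enorm_mul, ← ofReal_norm (Complex.exp _), norm_exp_neg_I_mul, ENNReal.ofReal_one, mul_one]

theorem aestronglyMeasurable_fourierHat {f : BlockSpace d k → ℂ}
    (hf : AEStronglyMeasurable f volume) :
    AEStronglyMeasurable (fun ω : BlockSphere d k => fourierHat f ω) (surfaceMeasure d k) := by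
  have h1 : ∀ ξ : BlockSpace d k, fourierHat f ξ
      = ∫ x, hf.mk f x * Complex.exp (-Complex.I * ((inner ℝ ξ x : ℝ) : ℂ)) := by
    intro ξ
    refine integral_congr_ae ?_
    filter_upwards [hf.ae_eq_mk] with x hx
    rw [hx]
  simp_rw [h1]
  refine StronglyMeasurable.aestronglyMeasurable ?_
  refine StronglyMeasurable.integral_prod_right (f := fun (ω : BlockSphere d k)
    (x : BlockSpace d k) => hf.mk f x *
      Complex.exp (-Complex.I * ((inner ℝ (ω : BlockSpace d k) x : ℝ) : ℂ))) ?_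
  refine StronglyMeasurable.mul (hf.stronglyMeasurable_mk.comp_measurable measurable_snd) ?_
  exact Measurable.stronglyMeasurable (by fun_prop)

theorem IsBlockSymmetric.ballTruncation {f : BlockSpace d k → ℂ} (hf : IsBlockSymmetric f)
    (N : ℕ) : IsBlockSymmetric (ballTruncation N f) := by
  intro U hU V hV
  funext x
  have h1 := congrFun (hf U hU V hV) x
  have h2 := norm_toEuclideanLin_fromBlocks hU hV x
  simp only [Function.comp_apply, _root_.ballTruncation, Set.indicator, mem_ball_zero_iff] at h1 ⊢
  rw [h1, h2]

/-- `G` is the limit in `L¹` of the sphere of the Fourier integrals of the truncations of `f`. -/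
def IsFourierLimit (f : BlockSpace d k → ℂ) (G : BlockSphere d k → ℂ) : Prop :=
  AEStronglyMeasurable G (surfaceMeasure d k) ∧
    Tendsto (fun N => ∫⁻ ω : BlockSphere d k, ‖fourierHat (ballTruncation N f) ω - G ω‖ₑ
      ∂surfaceMeasure d k) atTop (𝓝 0)

open Classical in
/-- The restriction operator: the `L¹` limit of the Fourier integrals of the truncations. -/
noncomputable def fourierRestriction (f : BlockSpace d k → ℂ) : BlockSphere d k → ℂ :=
  -- The value `0` is a default; for symmetric functions in the Lorentz space of the theorem a limit
  -- exists.
  if h : ∃ G, IsFourierLimit f G then h.choose else 0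

theorem IsFourierLimit.isFourierLimit_fourierRestriction {f : BlockSpace d k → ℂ}
    {G : BlockSphere d k → ℂ} (h : IsFourierLimit f G) :
    IsFourierLimit f (fourierRestriction f) := by
  have h' : ∃ G, IsFourierLimit f G := ⟨G, h⟩
  rw [fourierRestriction, dif_pos h']
  exact h'.choose_spec

theorem IsFourierLimit.ae_eq {f : BlockSpace d k → ℂ} {G H : BlockSphere d k → ℂ}
    (hf : ∀ N, Integrable (ballTruncation N f)) (hG : IsFourierLimit f G)
    (hH : IsFourierLimit f H) : G =ᵐ[surfaceMeasure d k] H := by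
  have hle : ∀ N, ∫⁻ ω, ‖G ω - H ω‖ₑ ∂surfaceMeasure d k
      ≤ ∫⁻ ω : BlockSphere d k, ‖fourierHat (ballTruncation N f) ω - G ω‖ₑ ∂surfaceMeasure d k
      + ∫⁻ ω : BlockSphere d k, ‖fourierHat (ballTruncation N f) ω - H ω‖ₑ
        ∂surfaceMeasure d k := by
    intro N
    have hmeas : AEMeasurable (fun ω : BlockSphere d k =>
        ‖fourierHat (ballTruncation N f) ω - G ω‖ₑ) (surfaceMeasure d k) :=
      ((aestronglyMeasurable_fourierHat (hf N).1).sub hG.1).enorm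
    rw [← lintegral_add_left' hmeas]
    refine lintegral_mono fun ω => ?_
    have : G ω - H ω = -(fourierHat (ballTruncation N f) ω - G ω)
        + (fourierHat (ballTruncation N f) ω - H ω) := by ring
    rw [this]
    exact (enorm_add_le _ _).trans (by rw [enorm_neg])
  have h0 : ∫⁻ ω, ‖G ω - H ω‖ₑ ∂surfaceMeasure d k = 0 := by
    have hlim := hG.2.add hH.2
    rw [add_zero] at hlim
    exact le_antisymm (ge_of_tendsto hlim (.of_forall hle)) zero_le
  have := (lintegral_eq_zero_iff' (hG.1.sub hH.1).enorm).1 h0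
  filter_upwards [this] with ω hω
  simpa [sub_eq_zero] using hω

theorem IsFourierLimit.ae_eq_fourierRestriction {f : BlockSpace d k → ℂ}
    {G : BlockSphere d k → ℂ} (hf : ∀ N, Integrable (ballTruncation N f))
    (hG : IsFourierLimit f G) : fourierRestriction f =ᵐ[surfaceMeasure d k] G :=
  hG.isFourierLimit_fourierRestriction.ae_eq hf hG

theorem IsFourierLimit.add {f g : BlockSpace d k → ℂ} {G H : BlockSphere d k → ℂ}
    (hf : ∀ N, Integrable (ballTruncation N f)) (hg : ∀ N, Integrable (ballTruncation N g))
    (hG : IsFourierLimit f G) (hH : IsFourierLimit g H) : IsFourierLimit (f + g) (G + H) := by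
  refine ⟨hG.1.add hH.1, ?_⟩
  have hlim := hG.2.add hH.2
  rw [add_zero] at hlim
  refine tendsto_of_tendsto_of_tendsto_of_le_of_le tendsto_const_nhds hlim
    (fun N => zero_le) fun N => ?_
  simp only
  have hmeas : AEMeasurable (fun ω : BlockSphere d k =>
      ‖fourierHat (ballTruncation N f) ω - G ω‖ₑ) (surfaceMeasure d k) :=
    ((aestronglyMeasurable_fourierHat (hf N).1).sub hG.1).enorm
  rw [← lintegral_add_left' hmeas]
  refine lintegral_mono fun ω => ?_
  rw [ballTruncation_add, fourierHat_add (hf N) (hg N), Pi.add_apply, add_sub_add_comm]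
  exact enorm_add_le _ _

theorem IsFourierLimit.smul {f : BlockSpace d k → ℂ} {G : BlockSphere d k → ℂ} (c : ℂ)
    (hG : IsFourierLimit f G) : IsFourierLimit (c • f) (c • G) := by
  refine ⟨hG.1.const_smul c, ?_⟩
  have hlim := ENNReal.Tendsto.const_mul hG.2 (Or.inr (enorm_ne_top (x := c)))
  rw [mul_zero] at hlim
  refine hlim.congr fun N => ?_
  rw [← lintegral_const_mul' _ _ enorm_ne_top]
  refine lintegral_congr fun ω => ?_
  rw [ballTruncation_smul, fourierHat_smul, Pi.smul_apply, smul_eq_mul, ← mul_sub, enorm_mul]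

/-- Consistency with the integral: truncations converge in `L¹`, hence their transforms converge
uniformly, and `σ` is finite. -/
theorem isFourierLimit_fourierHat {f : BlockSpace d k → ℂ} (hf : Integrable f) :
    IsFourierLimit f fun ω => fourierHat f ω := by
  refine ⟨aestronglyMeasurable_fourierHat hf.1, ?_⟩
  have hi : ∀ N : ℕ, Integrable (ballTruncation N f) :=
    fun N => hf.indicator Metric.isOpen_ball.measurableSet
  have h1 : Tendsto (fun N => ∫⁻ x, ‖(ballTruncation N f - f) x‖ₑ) atTop
      (𝓝 (∫⁻ _ : BlockSpace d k, 0)) := by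
    refine tendsto_lintegral_of_dominated_convergence' (fun x => ‖f x‖ₑ)
      (fun N => ((hi N).1.sub hf.1).enorm) (fun N => .of_forall fun x => ?_) hf.2.ne
      (.of_forall fun x => ?_)
    · simp only [Pi.sub_apply, ballTruncation]
      by_cases h : x ∈ Metric.ball (0 : BlockSpace d k) N <;> simp [Set.indicator, h]
    · obtain ⟨N₀, hN₀⟩ := exists_nat_gt ‖x‖
      refine tendsto_const_nhds.congr' ?_
      filter_upwards [eventually_ge_atTop N₀] with N hN
      have : x ∈ Metric.ball (0 : BlockSpace d k) N :=
        mem_ball_zero_iff.2 (hN₀.trans_le (by exact_mod_cast hN))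
      simp [ballTruncation, Set.indicator_of_mem this]
  rw [lintegral_zero] at h1
  have h2 := ENNReal.Tendsto.mul_const h1
    (Or.inr (measure_ne_top (surfaceMeasure d k) Set.univ))
  rw [zero_mul] at h2
  refine tendsto_of_tendsto_of_tendsto_of_le_of_le tendsto_const_nhds h2
    (fun N => zero_le) fun N => ?_
  simp only
  rw [← lintegral_const]
  refine lintegral_mono fun ω => ?_
  rw [← fourierHat_sub (hi N) hf]
  exact enorm_fourierHat_le _ _

/-- The a priori estimate, applied to differences of truncations, bounds them by the Lorentz
functional of a tail of `f`. The transforms are thus Cauchy in `L¹(σ)`, which is complete. -/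
theorem exists_isFourierLimit {r : ℝ} (hr : 0 < r) (hr1 : r ≤ 1) {K : ℝ≥0∞} (hK : K ≠ ∞)
    (hest : ∀ f : BlockSpace d k → ℂ, IsBlockSymmetric f → Integrable f →
      ∫⁻ ω : BlockSphere d k, ‖fourierHat f ω‖ₑ ∂surfaceMeasure d k
        ≤ K * distIntegral r volume f)
    {f : BlockSpace d k → ℂ} (hf : IsBlockSymmetric f) (hfm : AEStronglyMeasurable f volume)
    (hfin : distIntegral r volume f < ∞) : ∃ G, IsFourierLimit f G := by
  have hi : ∀ N, Integrable (ballTruncation N f) :=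
    integrable_ballTruncation hr hr1 hfm hfin
  have hmem : ∀ N, MemLp (fun ω : BlockSphere d k => fourierHat (ballTruncation N f) ω) 1
      (surfaceMeasure d k) := by
    intro N
    refine ⟨aestronglyMeasurable_fourierHat (hi N).1, ?_⟩
    rw [eLpNorm_one_eq_lintegral_enorm]
    refine (hest _ (hf.ballTruncation N) (hi N)).trans_lt (ENNReal.mul_lt_top hK.lt_top ?_)
    exact (distIntegral_mono hr.le (norm_ballTruncation_le N f)).trans_lt hfin
  have hdiff : ∀ n m N : ℕ, N ≤ n → N ≤ m →
      eLpNorm ((fun ω : BlockSphere d k => fourierHat (ballTruncation n f) ω)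
        - fun ω : BlockSphere d k => fourierHat (ballTruncation m f) ω) 1 (surfaceMeasure d k)
      ≤ K * distIntegral r volume (f - ballTruncation N f) := by
    intro n m N hn hm
    rw [eLpNorm_one_eq_lintegral_enorm]
    have h1 := hest _ ((hf.ballTruncation n).sub (hf.ballTruncation m)) ((hi n).sub (hi m))
    simp only [fourierHat_sub (hi n) (hi m)] at h1
    refine h1.trans ?_
    gcongr
    exact distIntegral_mono hr.le (norm_ballTruncation_sub_le hn hm f)
  set u : ℕ → Lp ℂ 1 (surfaceMeasure d k) := fun N => (hmem N).toLp _ with hu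
  have hcauchy : CauchySeq u := by
    refine EMetric.cauchySeq_iff_le_tendsto_0.2
      ⟨fun N => K * distIntegral r volume (f - ballTruncation N f), fun n m N hn hm => ?_, ?_⟩
    · rw [hu, Lp.edist_toLp_toLp]
      exact hdiff n m N hn hm
    · have := ENNReal.Tendsto.const_mul (tendsto_distIntegral_sub_ballTruncation hr hfm hfin)
        (Or.inr hK)
      rwa [mul_zero] at this
  obtain ⟨G, hG⟩ := cauchySeq_tendsto_of_complete hcauchy
  refine ⟨G, (Lp.memLp G).1, ?_⟩
  have h1 := (Lp.tendsto_Lp_iff_tendsto_eLpNorm' u G).1 hG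
  refine h1.congr fun N => ?_
  rw [eLpNorm_one_eq_lintegral_enorm]
  refine lintegral_congr_ae ?_
  filter_upwards [(hmem N).coeFn_toLp] with ω hω
  rw [Pi.sub_apply, hu, hω]

theorem IsFourierLimit.setLIntegral_le {f : BlockSpace d k → ℂ} {G : BlockSphere d k → ℂ}
    (hf : ∀ N, Integrable (ballTruncation N f)) (hG : IsFourierLimit f G)
    {F : Set (BlockSphere d k)} {K : ℝ≥0∞}
    (hK : ∀ N, ∫⁻ ω in F, ‖fourierHat (ballTruncation N f) ω‖ₑ ∂surfaceMeasure d k ≤ K) :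
    ∫⁻ ω in F, ‖G ω‖ₑ ∂surfaceMeasure d k ≤ K := by
  have hle : ∀ N, ∫⁻ ω in F, ‖G ω‖ₑ ∂surfaceMeasure d k
      ≤ K + ∫⁻ ω : BlockSphere d k, ‖fourierHat (ballTruncation N f) ω - G ω‖ₑ
        ∂surfaceMeasure d k := by
    intro N
    have hm := aestronglyMeasurable_fourierHat (d := d) (k := k) (hf N).1
    calc ∫⁻ ω in F, ‖G ω‖ₑ ∂surfaceMeasure d k
        ≤ ∫⁻ ω in F, (‖fourierHat (ballTruncation N f) ω‖ₑ
            + ‖fourierHat (ballTruncation N f) ω - G ω‖ₑ) ∂surfaceMeasure d k := by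
          refine lintegral_mono fun ω => ?_
          have : G ω = fourierHat (ballTruncation N f) ω
              + -(fourierHat (ballTruncation N f) ω - G ω) := by ring
          conv_lhs => rw [this]
          exact (enorm_add_le _ _).trans (by rw [enorm_neg])
      _ = _ := lintegral_add_left' hm.enorm.restrict _
      _ ≤ _ := add_le_add (hK N) (setLIntegral_le_lintegral _ _)
  have hlim := hG.2.const_add K
  rw [add_zero] at hlim
  exact ge_of_tendsto hlim (.of_forall hle)

end Restriction

theorem theorem4 (d k m : ℕ) (hd : 4 ≤ d) (hk : 2 ≤ k) (hkd : k ≤ d - 2)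
    (hm : m = min (d - k) k) :
    ∃ C : ℝ≥0,
      -- the estimate where the Fourier transform is given by its integral
      (∀ f : BlockSpace d k → ℂ, IsBlockSymmetric f →
        MemLorentz f (2 * m / (m + 1)) 1 volume → Integrable f volume →
        eLorentzNorm (fun ω : BlockSphere d k => fourierHat f ω) (2 * m / (m - 1)) ∞
            (surfaceMeasure d k)
          ≤ C * eLorentzNorm f (2 * m / (m + 1)) 1 volume) ∧
      -- the estimate on the whole symmetric Lorentz space
      ∃ R : (BlockSpace d k → ℂ) → BlockSphere d k → ℂ,
        IsRestrictionOperator (2 * m / (m + 1)) 1 R ∧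
        ∀ f : BlockSpace d k → ℂ, IsBlockSymmetric f →
          MemLorentz f (2 * m / (m + 1)) 1 volume →
          eLorentzNorm (R f) (2 * m / (m - 1)) ∞ (surfaceMeasure d k)
            ≤ C * eLorentzNorm f (2 * m / (m + 1)) 1 volume := by
  have hmd : m ≤ d - k := hm ▸ min_le_left _ _
  have hmk : m ≤ k := hm ▸ min_le_right _ _
  -- This makes `m - 1` positive, so that `2m/(m-1)` is a genuine finite exponent.
  have hm2 : 2 ≤ m := by rw [hm]; exact le_min (by omega) hk
  have hmR : (2 : ℝ) ≤ m := by exact_mod_cast hm2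
  obtain ⟨C, hC⟩ := exists_setLIntegral_fourierHat_le (d := d) (k := k) (by omega) hmd hmk
  set r : ℝ := ((m : ℝ) + 1) / (2 * m) with hr
  have hr0 : 0 < r := by positivity
  have hr1 : r ≤ 1 := by rw [hr, div_le_one (by linarith)]; linarith
  have hpr : 1 / (2 * (m : ℝ) / (m + 1)) = r := by rw [one_div_div]
  have hp'0 : 0 < 2 * (m : ℝ) / (m - 1) := div_pos (by linarith) (by linarith)
  have hp'r : 1 / (2 * (m : ℝ) / (m - 1)) = 1 - r := by
    rw [one_div_div, hr]
    field_simp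
    ring
  have hnorm : ∀ f : BlockSpace d k → ℂ, eLorentzNorm f (2 * m / (m + 1)) 1 volume
      = ENNReal.ofReal (2 * m / (m + 1)) * distIntegral r volume f := fun f => by
    rw [eLorentzNorm_one, hpr, distIntegral]
  -- The prefactor `p` of the `L^{p,1}` norm is at least `1`, so it can be dropped and `C` kept
  -- unchanged.
  have hp1 : (1 : ℝ) ≤ 2 * m / (m + 1) := by
    rw [one_le_div (by linarith)]; linarith
  have hnorm_le : ∀ f : BlockSpace d k → ℂ, distIntegral r volume f
      ≤ eLorentzNorm f (2 * m / (m + 1)) 1 volume := fun f => by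
    rw [hnorm]
    exact le_mul_of_one_le_left zero_le (by rwa [ENNReal.one_le_ofReal])
  have hfin : ∀ f : BlockSpace d k → ℂ, MemLorentz f (2 * m / (m + 1)) 1 volume →
      distIntegral r volume f < ∞ := fun f hf => (hnorm_le f).trans_lt hf.2
  have hint : ∀ f : BlockSpace d k → ℂ, MemLorentz f (2 * m / (m + 1)) 1 volume →
      ∀ N, Integrable (ballTruncation N f) :=
    fun f hf => integrable_ballTruncation hr0 hr1 hf.1 (hfin f hf)
  have hlim : ∀ f : BlockSpace d k → ℂ, IsBlockSymmetric f →
      MemLorentz f (2 * m / (m + 1)) 1 volume → IsFourierLimit f (fourierRestriction f) := by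
    intro f hs hf
    obtain ⟨G, hG⟩ := exists_isFourierLimit hr0 hr1
      (K := C * surfaceMeasure d k Set.univ ^ r) (ENNReal.mul_ne_top ENNReal.coe_ne_top
        (ENNReal.rpow_ne_top_of_nonneg hr0.le (measure_ne_top _ _)))
      (fun g hgs hg => by
        have := hC g hgs hg Set.univ .univ
        rwa [Measure.restrict_univ] at this) hs hf.1 (hfin f hf)
    exact hG.isFourierLimit_fourierRestriction
  refine ⟨C, fun f hs hf hfi => ?_, fourierRestriction, ⟨?_, ?_, ?_, ?_⟩, fun f hs hf => ?_⟩
  · refine (eLorentzNorm_top_le_of_setLIntegral_le (aestronglyMeasurable_fourierHat hfi.1)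
      (K := C * distIntegral r volume f) hp'0 hp'r fun F hF => ?_).trans
      (mul_le_mul_right (hnorm_le f) _)
    refine (hC f hs hfi F hF).trans (le_of_eq ?_)
    rw [distIntegral]
    ring
  · exact fun f hs hf => (hlim f hs hf).1
  · intro f g hfs hf hgs hg
    refine ((hlim f hfs hf).add (hint f hf) (hint g hg) (hlim g hgs hg)).ae_eq_fourierRestriction
      fun N => ?_
    rw [ballTruncation_add]
    exact (hint f hf N).add (hint g hg N)
  · intro c f hfs hf
    refine ((hlim f hfs hf).smul c).ae_eq_fourierRestriction fun N => ?_
    rw [ballTruncation_smul]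
    exact (hint f hf N).smul c
  · exact fun f _ hf hfi => (isFourierLimit_fourierHat hfi).ae_eq_fourierRestriction (hint f hf)
  · refine (eLorentzNorm_top_le_of_setLIntegral_le (hlim f hs hf).1
      (K := C * distIntegral r volume f) hp'0 hp'r fun F hF => ?_).trans
      (mul_le_mul_right (hnorm_le f) _)
    refine (hlim f hs hf).setLIntegral_le (hint f hf) fun N => ?_
    refine (hC _ (hs.ballTruncation N) (hint f hf N) F hF).trans ?_
    have := distIntegral_mono hr0.le (norm_ballTruncation_le N f) (μ := volume)
    calc _ ≤ C * surfaceMeasure d k F ^ r * distIntegral r volume f :=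
          mul_le_mul_right this _
      _ = _ := by ring
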